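/- There are a randomized algorithm $P$ and a constant $c$ such that for every constant $s$ there is $n_0$ for which the following holds. Let $\mathcal L=(A,B,E,\Sigma,\{\pi_e\}_{e\in E})$ be a Label Cover instance, that is, a bipartite graph $(A,B,E)$ with an alphabet $\Sigma$ and a projection $\pi_{(a,b)}:\Sigma\to\Sigma$ for every edge $(a,b)\in E$. Its value $\mathrm{val}(\mathcal L)$ is the maximum, over all $\phi:A\cup B\to\Sigma$, of the fraction of edges $(a,b)$ with $\pi_{(a,b)}(\phi(a))=\phi(b)$, and $\mathcal L$ is satisfiable if some $\phi$ satisfies all edges. Suppose that the graph is bi-regular (all vertices of $A$ have the same degree, and so do all vertices of $B$), that $E\neq\emptyset$, that $2\le|\Sigma|\le s$, and that $n=|A|+|B|\ge n_0$. Put $$r=\frac{\sqrt n}{\log_2 n},\qquad k=\frac{10^{10}\,|E|\log_2|\Sigma|}{r^2}.$$ On input $\mathcal L$, the algorithm $P$ outputs (as an explicit incidence matrix) a finite ground set $\mathcal U$ and a class $\mathcal C$ of subsets of $\mathcal U$ such that: * (Size) for all outcomes of the coin flips, $P$ halts within $2^{rk}\,|\Sigma|^{c|E|/r}$ steps, and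 $|\mathcal C|,|\mathcal U|\le 2^{rk}\,|\Sigma|^{c|E|/r}$; * (Completeness) if $\mathcal L$ is satisfiable, then for all outcomes of the coin flips the Littlestone dimension satisfies $\mathrm{LS}(\mathcal C,\mathcal U)\ge 2rk$; * (Soundness) if $\mathrm{val}(\mathcal L)\le 0.001$, then $\mathrm{LS}(\mathcal C,\mathcal U)\le(2-\varepsilon)rk$ with $\varepsilon=0.001$, with probability at least $1-1/n$ over the coin flips. Here $\mathrm{LS}(\mathcal C,\mathcal U)$ is the largest $d$ for which there is a full binary tree of depth $d$ with internal nodes labelled by elements of $\mathcal U$ such that for every leaf some $C\in\mathcal C$ contains exactly those labels on the path from the root to the leaf at which the path turns to the child $1$. Algorithms are programs for a random access machine with addition, subtraction, indirect addressing and fair coin flips, at unit cost per operation. -/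

import Mathlib

/-! ### Mistake trees and Littlestone's dimension -/

/-- `v` is a depth-`d` mistake tree for the concept class `𝒞` over the universe `U`. The tree is the
full binary tree of depth `d`; `v i s` is the element at the internal node addressed by the binary
string `s` of length `i < d`. For every leaf `l`, some concept agrees with the path to it. -/
def IsMistakeTree {U : Type*} (𝒞 : Set (Set U)) (d : ℕ)
    (v : (i : Fin d) → (Fin i → Bool) → U) : Prop :=
  ∀ l : Fin d → Bool, ∃ C ∈ 𝒞, ∀ i : Fin d,
    (v i (fun j => l (Fin.castLE i.isLt.le j)) ∈ C ↔ l i = true)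

/-- Littlestone's dimension: the maximum depth of a mistake tree.
(For a finite class the set of depths is bounded, see `bddAbove_mistakeTree`.) -/
noncomputable def littlestoneDim {U : Type*} (𝒞 : Set (Set U)) : ℕ :=
  sSup {d : ℕ | ∃ v : (i : Fin d) → (Fin i → Bool) → U, IsMistakeTree 𝒞 d v}

/-- Distinct leaves of a mistake tree need distinct concepts. -/
theorem IsMistakeTree.two_pow_le {U : Type*} {𝒞 : Set (Set U)} (h𝒞 : 𝒞.Finite) {d : ℕ}
    {v : (i : Fin d) → (Fin i → Bool) → U} (hv : IsMistakeTree 𝒞 d v) : 2 ^ d ≤ 𝒞.ncard := by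
  classical
  choose f hf hfl using hv
  have hinj : Function.Injective f := by
    intro l l' h
    have key : ∀ N : ℕ, ∀ hN : N < d, l ⟨N, hN⟩ = l' ⟨N, hN⟩ := by
      intro N
      induction N using Nat.strong_induction_on with
      | _ N ih =>
        intro hN
        have h1 := hfl l ⟨N, hN⟩
        have h2 := hfl l' ⟨N, hN⟩
        have h3 : (fun j : Fin N => l (Fin.castLE hN.le j))
            = (fun j : Fin N => l' (Fin.castLE hN.le j)) := by
          funext j
          exact ih j.1 j.2 (j.2.trans hN)
        rw [h] at h1
        simp only [h3] at h1
        have h4 := h1.symm.trans h2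
        exact Bool.eq_iff_iff.mpr h4
    funext i
    exact key i.1 i.2
  have h1 : (Set.range f).ncard = 2 ^ d := by
    rw [← Set.image_univ, Set.ncard_image_of_injective _ hinj, Set.ncard_univ]
    simp
  rw [← h1]
  exact Set.ncard_le_ncard (by rintro _ ⟨l, rfl⟩; exact hf l) h𝒞

theorem bddAbove_mistakeTree {U : Type*} {𝒞 : Set (Set U)} (h𝒞 : 𝒞.Finite) :
    BddAbove {d : ℕ | ∃ v : (i : Fin d) → (Fin i → Bool) → U, IsMistakeTree 𝒞 d v} := by
  refine ⟨𝒞.ncard, ?_⟩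
  rintro d ⟨v, hv⟩
  exact (Nat.lt_two_pow_self).le.trans (hv.two_pow_le h𝒞)

/-! ### Label Cover -/

/-- A Label Cover instance on a simple bipartite graph with sides `A`, `B`, edges indexed by `E`,
alphabet `S`, and a projection constraint for every edge. -/
structure LabelCover (A B E S : Type*) where
  src : E → A
  tgt : E → B
  proj : E → S → S
  simple : Function.Injective fun e => (src e, tgt e)

namespace LabelCover

variable {A B E S : Type*}

/-- The edge `e` is satisfied by the assignment `φ`. -/
def Sat (L : LabelCover A B E S) (φ : A ⊕ B → S) (e : E) : Prop :=
  L.proj e (φ (Sum.inl (L.src e))) = φ (Sum.inr (L.tgt e))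

/-- Some assignment satisfies all edges. -/
def Satisfiable (L : LabelCover A B E S) : Prop :=
  ∃ φ : A ⊕ B → S, ∀ e, L.Sat φ e

/-- The fraction of edges satisfied by `φ`. -/
noncomputable def assignmentValue (L : LabelCover A B E S) (φ : A ⊕ B → S) : ℝ :=
  (Nat.card {e : E // L.Sat φ e} : ℝ) / Nat.card E

/-- The value of the instance: the maximum over all assignments. -/
noncomputable def value (L : LabelCover A B E S) : ℝ :=
  ⨆ φ : A ⊕ B → S, L.assignmentValue φ

/-- All vertices of `A` have the same degree, and so have all vertices of `B`. -/
def BiRegular (L : LabelCover A B E S) : Prop :=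
  (∃ dA : ℕ, ∀ x : A, Nat.card {e : E // L.src e = x} = dA) ∧
  (∃ dB : ℕ, ∀ y : B, Nat.card {e : E // L.tgt e = y} = dB)

/-- The description of an instance as a list of numbers: `|A|, |B|, |S|, |E|`, and then, for every
edge, its two endpoints and the table of its projection. -/
def encode {a b m q : ℕ} (L : LabelCover (Fin a) (Fin b) (Fin m) (Fin q)) : List ℕ :=
  [a, b, q, m] ++ (List.finRange m).flatMap fun e =>
    [(L.src e : ℕ), (L.tgt e : ℕ)] ++ (List.finRange q).map fun s => (L.proj e s : ℕ)

end LabelCover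

/-! ### Explicitly given concept classes -/

/-- A ground set `Fin numElems` with a concept class, given by its incidence matrix. -/
structure ConceptTable where
  numElems : ℕ
  numConcepts : ℕ
  mem : Fin numConcepts → Fin numElems → Bool

namespace ConceptTable

/-- The concept class described by a table. -/
def conceptClass (D : ConceptTable) : Set (Set (Fin D.numElems)) :=
  Set.range fun c => {x | D.mem c x = true}

/-- The description of a table as a list of numbers: the two sizes, then the matrix entries. -/
def encode (D : ConceptTable) : List ℕ :=
  [D.numElems, D.numConcepts] ++ (List.finRange D.numConcepts).flatMap fun c =>
    (List.finRange D.numElems).map fun x => if D.mem c x then 1 else 0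

end ConceptTable

/-! ### Randomized random access machines -/

namespace RAM

/-- Programs of a random access machine with registers, an indirectly addressed memory, a
write-only output, addition and truncated subtraction of natural numbers, and fair coin flips. -/
inductive Program : Type
  /-- `reg x := c` -/
  | const (x c : ℕ)
  /-- `reg x := reg y + reg z` -/
  | add (x y z : ℕ)
  /-- `reg x := reg y - reg z`, truncated at zero -/
  | sub (x y z : ℕ)
  /-- `reg x := mem (reg y)` -/
  | load (x y : ℕ)
  /-- `mem (reg x) := reg y` -/
  | store (x y : ℕ)
  /-- `reg x :=` a fresh random bit -/
  | flip (x : ℕ)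
  /-- append `reg x` to the output -/
  | emit (x : ℕ)
  /-- run `p`, then `p'` -/
  | seq (p p' : Program)
  /-- run `p` if `reg x ≠ 0`, and `p'` otherwise -/
  | cond (x : ℕ) (p p' : Program)
  /-- repeat `p` as long as `reg x ≠ 0` -/
  | loop (x : ℕ) (p : Program)

/-- A state of the machine; `flips` is the number of coins flipped so far. -/
structure State where
  reg : ℕ → ℕ
  mem : ℕ → ℕ
  flips : ℕ
  out : List ℕ

/-- Set register `x` to `c`. -/
def State.setReg (s : State) (x c : ℕ) : State :=
  { s with reg := Function.update s.reg x c }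

/-- The initial state: the input is in the first memory cells, all else is zero. -/
def initial (input : List ℕ) : State where
  reg := fun _ => 0
  mem := fun i => input.getD i 0
  flips := 0
  out := []

/-- `Exec ω p s s' t`: with `ω i` as outcome of the `i`-th coin flip, the program `p` started in
state `s` halts in state `s'` after exactly `t` steps. Every basic instruction and every test of a
branch or of a loop takes one step. -/
inductive Exec (ω : ℕ → Bool) : Program → State → State → ℕ → Prop
  | const (s : State) (x c : ℕ) : Exec ω (.const x c) s (s.setReg x c) 1
  | add (s : State) (x y z : ℕ) : Exec ω (.add x y z) s (s.setReg x (s.reg y + s.reg z)) 1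
  | sub (s : State) (x y z : ℕ) : Exec ω (.sub x y z) s (s.setReg x (s.reg y - s.reg z)) 1
  | load (s : State) (x y : ℕ) : Exec ω (.load x y) s (s.setReg x (s.mem (s.reg y))) 1
  | store (s : State) (x y : ℕ) :
      Exec ω (.store x y) s { s with mem := Function.update s.mem (s.reg x) (s.reg y) } 1
  | flip (s : State) (x : ℕ) :
      Exec ω (.flip x) s
        { s.setReg x (if ω s.flips then 1 else 0) with flips := s.flips + 1 } 1
  | emit (s : State) (x : ℕ) : Exec ω (.emit x) s { s with out := s.out ++ [s.reg x] } 1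
  | seq {p p' : Program} {s s' s'' : State} {t t' : ℕ} :
      Exec ω p s s' t → Exec ω p' s' s'' t' → Exec ω (.seq p p') s s'' (t + t')
  | cond_pos {x : ℕ} {p p' : Program} {s s' : State} {t : ℕ} :
      s.reg x ≠ 0 → Exec ω p s s' t → Exec ω (.cond x p p') s s' (t + 1)
  | cond_neg {x : ℕ} {p p' : Program} {s s' : State} {t : ℕ} :
      s.reg x = 0 → Exec ω p' s s' t → Exec ω (.cond x p p') s s' (t + 1)
  | loop_stop {x : ℕ} {p : Program} {s : State} :
      s.reg x = 0 → Exec ω (.loop x p) s s 1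
  | loop_step {x : ℕ} {p : Program} {s s' s'' : State} {t t' : ℕ} :
      s.reg x ≠ 0 → Exec ω p s s' t → Exec ω (.loop x p) s' s'' t' →
        Exec ω (.loop x p) s s'' (t + t' + 1)

/-- On the given input and coin outcomes, `p` halts after exactly `t` steps with the given
output. -/
def Outputs (p : Program) (ω : ℕ → Bool) (input output : List ℕ) (t : ℕ) : Prop :=
  ∃ s : State, Exec ω p (initial input) s t ∧ s.out = output

/-- The distribution of an infinite sequence of independent fair coin flips. -/
noncomputable def coinMeasure : MeasureTheory.Measure (ℕ → Bool) :=
  MeasureTheory.Measure.infinitePi fun _ => (PMF.uniformOfFintype Bool).toMeasure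

end RAM

/-! The adversary has to commit to a labelling of `B` before it learns on which part of `A` it will
be tested. Split `A` by residues into `R = ⌊√n⌋` blocks and `B` into `RB ≤ R` blocks, and let `Y` be
a number of rounds between `rk` and `1.05 rk`. A concept is a triple `(T, W, α)` of two `Y`-bit
strings and the labels `α` of one block of `A`, namely the block whose Hadamard code word is decoded
from `W`. A commitment `(t, σ)` belongs to it if bit `t` of `T` is set and no edge between that
block, labelled by `α`, and the block `t mod RB` of `B`, labelled by `σ`, is violated. A challenge
`(θ, t)` belongs to it if `θ = T` and bit `t` of `W` is set.

Completeness (`Layout.le_littlestoneDim`): given a satisfying assignment, query `Y` commitments to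
its labels, and then the `Y` challenges that quote the answers received. All `2Y` answers are free:
the first half is `T`, the second half is `W`, and the assignment supplies a suitable `α` whichever
block `W` selects.

Soundness (`noMistakeTree_commit`, `noMistakeTree_challenge`): a learner predicts non-membership at
each uncommitted place and at the first challenge, so a mistake there yields a new commitment or
reveals `T`. Where only the candidate pair (block, `α`) matters it follows the majority, which costs
at most `u ≈ log₂(R q^H)` mistakes, a negligible number. If `T` is revealed before half of the
places are committed, the remaining `Y` bits of `W` cost about `1.5 Y` in total. Otherwise the
commitments label at least `1/8` of `B`, and since the value is small, some block `i` has no labels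
consistent with them (`LabelCover.BiRegular.exists_viol`). Hence `W` does not decode to `i`, so it
agrees with the code word of `i` in at most `4Y/5` places (`card_agree_lt`); predicting the
complement of that word brings the total to about `1.8 Y < (2 - ε) rk`.

The table is polynomial in `2 ^ Y`, and a calculus of programs with polynomial cost shows the same
for the running time. Since `q ^ (m / r) = 2 ^ (rk / 10 ^ 10)`, a suitable constant `c` absorbs
every fixed power of `2 ^ Y`. No coins are flipped, so soundness holds with certainty. -/

namespace RAM

/-! ### A calculus of functions computable with polynomial cost -/

/-- A loop whose body takes `I i` to `I (i + 1)` in at most `τ` steps. -/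
theorem Exec.exists_loop {ω : ℕ → Bool} {x τ N : ℕ} {p : Program} (I : ℕ → State → Prop)
    (hstep : ∀ i < N, ∀ s, I i s → s.reg x ≠ 0 ∧ ∃ s' t, Exec ω p s s' t ∧ I (i + 1) s' ∧ t ≤ τ)
    (hfin : ∀ s, I N s → s.reg x = 0) {s : State} (hs : I 0 s) :
    ∃ s' t, Exec ω (.loop x p) s s' t ∧ I N s' ∧ t ≤ N * (τ + 1) + 1 := by
  have key : ∀ j ≤ N, ∀ s, I (N - j) s →
      ∃ s' t, Exec ω (.loop x p) s s' t ∧ I N s' ∧ t ≤ j * (τ + 1) + 1 := by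
    intro j
    induction j with
    | zero => exact fun _ s h => ⟨s, 1, Exec.loop_stop (hfin s h), h, by simp⟩
    | succ j ih =>
      intro hj s h
      obtain ⟨h0, s₁, t₁, e₁, i₁, b₁⟩ := hstep _ (by omega) s h
      rw [show N - (j + 1) + 1 = N - j by omega] at i₁
      obtain ⟨s₂, t₂, e₂, i₂, b₂⟩ := ih (by omega) s₁ i₁
      refine ⟨s₂, _, .loop_step h0 e₁ e₂, i₂, ?_⟩
      rw [Nat.succ_mul]
      omega
  exact key N le_rfl s (by simpa using hs)

/-- Repeat `p` as often as the register `k + 2` says. The register `k` counts the rounds, and `p` is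
expected to leave the new value of the accumulator `k + 1` in the register `k + 4`. At the end the
accumulator is moved to the register `k`. -/
def forLoop (k : ℕ) (p : Program) : Program :=
  .seq (.const (k + 3) 1) (.seq (.const k 0) (.seq
    (.loop (k + 2) (.seq p (.seq (.const (k + 5) 0) (.seq (.add (k + 1) (k + 4) (k + 5))
      (.seq (.add k k (k + 3)) (.sub (k + 2) (k + 2) (k + 3)))))))
    (.seq (.const (k + 5) 0) (.add k (k + 1) (k + 5)))))

/-- The output `O i` is tracked next to the accumulator `F i`, so that one loop serves both for
computing numbers and for emitting lists. The body has to preserve the registers below `k + 4` and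
may overwrite all others. -/
theorem exec_forLoop {ω : ℕ → Bool} {k n τ : ℕ} {p : Program} (s : State) (F : ℕ → ℕ)
    (O : ℕ → List ℕ)
    (hp : ∀ i < n, ∀ ρ : ℕ → ℕ, (∀ j < k, ρ j = s.reg j) → ρ k = i → ρ (k + 1) = F i →
      ∃ ρ' t, Exec ω p { s with reg := ρ, out := O i } { s with reg := ρ', out := O (i + 1) } t ∧
        (∀ j < k + 4, ρ' j = ρ j) ∧ ρ' (k + 4) = F (i + 1) ∧ t ≤ τ)
    (ρ : ℕ → ℕ) (h0 : ∀ j < k, ρ j = s.reg j) (h1 : ρ (k + 1) = F 0) (h2 : ρ (k + 2) = n) :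
    ∃ ρ' t, Exec ω (forLoop k p) { s with reg := ρ, out := O 0 }
      { s with reg := ρ', out := O n } t ∧ (∀ j < k, ρ' j = s.reg j) ∧ ρ' k = F n ∧
      t ≤ n * (τ + 5) + 5 := by
  -- The register `k + 2` counts down the remaining rounds, and `k + 3` holds the constant `1`.
  let I : ℕ → State → Prop := fun i s' => i ≤ n ∧ ∃ ρ' : ℕ → ℕ,
    s' = { s with reg := ρ', out := O i } ∧
    (∀ j < k, ρ' j = s.reg j) ∧ ρ' k = i ∧ ρ' (k + 1) = F i ∧ ρ' (k + 2) = n - i ∧ ρ' (k + 3) = 1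
  obtain ⟨s₁, t₁, e₁, ⟨_, ρ₁, rfl, a₁, _, a₃, _, _⟩, b₁⟩ := Exec.exists_loop (ω := ω) (x := k + 2)
    (N := n) (τ := τ + 4) I
    (p := .seq p (.seq (.const (k + 5) 0) (.seq (.add (k + 1) (k + 4) (k + 5))
      (.seq (.add k k (k + 3)) (.sub (k + 2) (k + 2) (k + 3))))))
    (by
      rintro i hi _ ⟨_, ρ', rfl, c0, c1, c2, c3, c4⟩
      refine ⟨by simp only [c3]; omega, ?_⟩
      obtain ⟨ρ'', t, e, d1, d2, d3⟩ := hp i hi ρ' c0 c1 c2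
      refine ⟨_, _, .seq e (.seq (.const _ _ _) (.seq (.add _ _ _ _) (.seq (.add _ _ _ _)
        (.sub _ _ _ _)))), ⟨hi, _, rfl, ?_, ?_, ?_, ?_, ?_⟩, ?_⟩
      · intro j hj
        simp [State.setReg, show j ≠ k by omega, show j ≠ k + 1 by omega,
          show j ≠ k + 2 by omega, show j ≠ k + 5 by omega, d1 j (by omega), c0 j hj]
      · simp [State.setReg, d1 k (by omega), d1 (k + 3) (by omega), c1, c4]
      · simp [State.setReg, d2]
      · simp [State.setReg, d1 (k + 2) (by omega), d1 (k + 3) (by omega),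
          c3, c4]
        omega
      · simp [State.setReg, d1 (k + 3) (by omega), c4]
      · omega)
    (by
      rintro _ ⟨_, ρ', rfl, c0, c1, c2, c3, c4⟩
      simpa using c3)
    (s := (({ s with reg := ρ, out := O 0 } : State).setReg (k + 3) 1).setReg k 0)
    ⟨Nat.zero_le _, _, rfl, fun j hj => by
        simp [State.setReg, show j ≠ k by omega, show j ≠ k + 3 by omega,
          h0 j hj],
      by simp [State.setReg],
      by simp [State.setReg, h1],
      by simp [State.setReg, h2],
      by simp [State.setReg]⟩
  refine ⟨_, _, .seq (.const _ _ _) (.seq (.const _ _ _) (.seq e₁ (.seq (.const _ _ _)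
    (.add _ _ _ _)))), ?_, ?_, ?_⟩
  · intro j hj
    simp [State.setReg, show j ≠ k by omega, show j ≠ k + 5 by omega,
      a₁ j hj]
  · simp [State.setReg, a₃]
  · rw [show τ + 5 = τ + 4 + 1 by rfl]
    omega

/-- What a program may rely on: a family of situations `Γ`, the memory, a size bounding the cost,
and a relation on the registers below `width`. -/
structure Ctx (Γ : Type) where
  mem : Γ → ℕ → ℕ
  size : Γ → ℕ
  two_le : ∀ γ, 2 ≤ size γ
  width : ℕ
  holds : Γ → (ℕ → ℕ) → Prop
  congr : ∀ γ ρ ρ', (∀ i < width, ρ' i = ρ i) → holds γ ρ → holds γ ρ'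

/-- `f` is bounded by a power of the size. -/
def Ctx.Poly {Γ : Type} (c : Ctx Γ) (f : Γ → ℕ) : Prop := ∃ d, ∀ γ, f γ ≤ c.size γ ^ d

/-- `f` can be computed into any register `k` outside of the context, preserving all registers below
`k`, at a cost polynomial in the size. -/
def Ctx.Comp {Γ : Type} (c : Ctx Γ) (f : Γ → ℕ) : Prop :=
  ∀ k, c.width ≤ k → ∃ p τ, c.Poly τ ∧ ∀ γ ω s, s.mem = c.mem γ → c.holds γ s.reg →
    ∃ ρ t, Exec ω p s { s with reg := ρ } t ∧ (∀ i < k, ρ i = s.reg i) ∧ ρ k = f γ ∧ t ≤ τ γ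

/-- The list `g` can be appended to the output at a cost polynomial in the size. -/
def Ctx.Emits {Γ : Type} (c : Ctx Γ) (g : Γ → List ℕ) : Prop :=
  ∀ k, c.width ≤ k → ∃ p τ, c.Poly τ ∧ ∀ γ ω s, s.mem = c.mem γ → c.holds γ s.reg →
    ∃ ρ t, Exec ω p s { s with reg := ρ, out := s.out ++ g γ } t ∧ (∀ i < k, ρ i = s.reg i) ∧
      t ≤ τ γ

/-- `c'` is an extension of `c` along `π`. -/
structure Ctx.Over {Γ Γ' : Type} (c' : Ctx Γ') (c : Ctx Γ) (π : Γ' → Γ) : Prop where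
  mem : ∀ γ, c'.mem γ = c.mem (π γ)
  size : ∀ γ, c'.size γ = c.size (π γ)
  width : c.width ≤ c'.width
  holds : ∀ γ ρ, c'.holds γ ρ → c.holds (π γ) ρ

/-- The situations inside of a loop. -/
def Iter {Γ : Type} (n : Γ → ℕ) : Type := {x : Γ × ℕ // x.2 < n x.1}

/-- The situation in which the loop was entered. -/
def Iter.base {Γ : Type} {n : Γ → ℕ} (x : Iter n) : Γ := x.1.1

/-- The number of finished rounds. -/
def Iter.idx {Γ : Type} {n : Γ → ℕ} (x : Iter n) : ℕ := x.1.2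

theorem Iter.lt {Γ : Type} {n : Γ → ℕ} (x : Iter n) : x.idx < n x.base := x.2

namespace Ctx

variable {Γ Γ' : Type} {c : Ctx Γ} {c' : Ctx Γ'} {π : Γ' → Γ} {f g h n : Γ → ℕ}

theorem one_le_pow (c : Ctx Γ) (γ : Γ) (d : ℕ) : 1 ≤ c.size γ ^ d :=
  Nat.one_le_pow _ _ (by have := c.two_le γ; omega)

theorem Poly.mono (hg : c.Poly g) (h : ∀ γ, f γ ≤ g γ) : c.Poly f := by
  obtain ⟨d, hd⟩ := hg
  exact ⟨d, fun γ => (h γ).trans (hd γ)⟩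

theorem Poly.const (m : ℕ) : c.Poly fun _ => m :=
  ⟨m, fun γ => Nat.lt_two_pow_self.le.trans (Nat.pow_le_pow_left (c.two_le γ) m)⟩

theorem Poly.mul (hf : c.Poly f) (hg : c.Poly g) : c.Poly fun γ => f γ * g γ := by
  obtain ⟨d, hd⟩ := hf
  obtain ⟨e, he⟩ := hg
  exact ⟨d + e, fun γ => by rw [pow_add]; exact Nat.mul_le_mul (hd γ) (he γ)⟩

theorem Poly.add (hf : c.Poly f) (hg : c.Poly g) : c.Poly fun γ => f γ + g γ := by
  obtain ⟨d, hd⟩ := hf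
  obtain ⟨e, he⟩ := hg
  refine ⟨d + e + 1, fun γ => ?_⟩
  have h1 : c.size γ ^ d ≤ c.size γ ^ (d + e) :=
    Nat.pow_le_pow_right (by have := c.two_le γ; omega) (by omega)
  have h2 : c.size γ ^ e ≤ c.size γ ^ (d + e) :=
    Nat.pow_le_pow_right (by have := c.two_le γ; omega) (by omega)
  have h3 := Nat.mul_le_mul_left (c.size γ ^ (d + e)) (c.two_le γ)
  have := hd γ
  have := he γ
  show f γ + g γ ≤ _
  rw [pow_succ]
  omega

theorem Poly.pow (hf : c.Poly f) (m : ℕ) : c.Poly fun γ => f γ ^ m := by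
  obtain ⟨d, hd⟩ := hf
  exact ⟨d * m, fun γ => by rw [pow_mul]; exact Nat.pow_le_pow_left (hd γ) m⟩

theorem Poly.size : c.Poly c.size := ⟨1, fun γ => by simp⟩

theorem Over.poly (h : c'.Over c π) (hf : c.Poly f) : c'.Poly fun γ => f (π γ) := by
  obtain ⟨d, hd⟩ := hf
  exact ⟨d, fun γ => by rw [h.size]; exact hd _⟩

theorem Over.poly_idx {c' : Ctx (Iter n)} (h : c'.Over c Iter.base) (hn : c.Poly n) :
    c'.Poly Iter.idx :=
  (h.poly hn).mono fun x => x.lt.le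

theorem Over.comp (h : c'.Over c π) (hf : c.Comp f) : c'.Comp fun γ => f (π γ) := by
  intro k hk
  obtain ⟨p, τ, hτ, hp⟩ := hf k (h.width.trans hk)
  refine ⟨p, _, h.poly hτ, fun γ ω s hm hh => hp (π γ) ω s ?_ (h.holds _ _ hh)⟩
  rw [hm, h.mem]

theorem Comp.of_eq (hf : c.Comp f) (h : ∀ γ, f γ = g γ) : c.Comp g := by
  rwa [← funext h]

theorem Comp.const (m : ℕ) : c.Comp fun _ => m := fun k _ =>
  ⟨.const k m, fun _ => 1, .const 1, fun _ _ s _ _ =>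
    ⟨_, 1, .const s k m, fun i hi => by simp [hi.ne], by simp, le_rfl⟩⟩

theorem Comp.of_reg (r : ℕ) (hr : r < c.width) (h : ∀ γ ρ, c.holds γ ρ → ρ r = f γ) :
    c.Comp f := fun k hk =>
  ⟨.seq (.const k 0) (.add k r k), fun _ => 2, .const 2, fun γ ω s _ hs =>
    ⟨_, 2, .seq (.const s k 0) (.add _ k r k), fun i hi => by simp [State.setReg, hi.ne],
      by simp [State.setReg, (hr.trans_le hk).ne, h γ _ hs], le_rfl⟩⟩

theorem Comp.load (hf : c.Comp f) : c.Comp fun γ => c.mem γ (f γ) := by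
  intro k hk
  obtain ⟨p, τ, hτ, hp⟩ := hf k hk
  refine ⟨.seq p (.load k k), _, hτ.add (.const 1), fun γ ω s hm hs => ?_⟩
  obtain ⟨ρ, t, e, h1, h2, h3⟩ := hp γ ω s hm hs
  exact ⟨_, _, .seq e (.load _ k k), fun i hi => by simp [hi.ne, h1 i hi], by simp [h2, hm],
    by simpa using h3⟩

/-- The second operand is computed into `k + 1`, which leaves the first one in the register `k`
intact. -/
theorem Comp.binary (op : ℕ → ℕ → ℕ) (P : ℕ → ℕ → ℕ → Program)
    (hP : ∀ ω s x y z, Exec ω (P x y z) s (s.setReg x (op (s.reg y) (s.reg z))) 1)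
    (hf : c.Comp f) (hg : c.Comp g) : c.Comp fun γ => op (f γ) (g γ) := by
  intro k hk
  obtain ⟨p, τ, hτ, hp⟩ := hf k hk
  obtain ⟨p', τ', hτ', hp'⟩ := hg (k + 1) (hk.trans (Nat.le_succ k))
  refine ⟨.seq p (.seq p' (P k k (k + 1))), _, hτ.add (hτ'.add (.const 1)),
    fun γ ω s hm hs => ?_⟩
  obtain ⟨ρ, t, e, h1, h2, h3⟩ := hp γ ω s hm hs
  obtain ⟨ρ', t', e', h1', h2', h3'⟩ := hp' γ ω { s with reg := ρ } hm
    (c.congr _ _ _ (fun i hi => h1 i (hi.trans_le hk)) hs)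
  refine ⟨_, _, .seq e (.seq e' (hP ω _ k k (k + 1))), fun i hi => ?_, ?_, ?_⟩
  · simp [hi.ne, h1' i (by omega), h1 i hi]
  · simp [h1' k (by omega), h2, h2']
  · show t + (t' + 1) ≤ τ γ + (τ' γ + 1)
    omega

theorem Comp.add (hf : c.Comp f) (hg : c.Comp g) : c.Comp fun γ => f γ + g γ :=
  .binary _ .add (fun _ => .add) hf hg

theorem Comp.sub (hf : c.Comp f) (hg : c.Comp g) : c.Comp fun γ => f γ - g γ :=
  .binary _ .sub (fun _ => .sub) hf hg

theorem Comp.ite (hf : c.Comp f) (hg : c.Comp g) (hh : c.Comp h) :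
    c.Comp fun γ => if f γ ≠ 0 then g γ else h γ := by
  intro k hk
  obtain ⟨p, τ, hτ, hp⟩ := hf k hk
  obtain ⟨p₁, τ₁, hτ₁, hp₁⟩ := hg k hk
  obtain ⟨p₂, τ₂, hτ₂, hp₂⟩ := hh k hk
  refine ⟨.seq p (.cond k p₁ p₂), _, hτ.add (hτ₁.add (hτ₂.add (.const 1))),
    fun γ ω s hm hs => ?_⟩
  obtain ⟨ρ, t, e, h1, h2, h3⟩ := hp γ ω s hm hs
  have hs' := c.congr _ _ _ (fun i hi => h1 i (hi.trans_le hk)) hs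
  by_cases h0 : f γ = 0
  · obtain ⟨ρ', t', e', h1', h2', h3'⟩ := hp₂ γ ω { s with reg := ρ } hm hs'
    refine ⟨_, _, .seq e (.cond_neg (by simpa [h2] using h0) e'), fun i hi => ?_, ?_, ?_⟩
    · rw [h1' i hi, ← h1 i hi]
    · simp [h0, h2']
    · show t + (t' + 1) ≤ τ γ + (τ₁ γ + (τ₂ γ + 1))
      omega
  · obtain ⟨ρ', t', e', h1', h2', h3'⟩ := hp₁ γ ω { s with reg := ρ } hm hs'
    refine ⟨_, _, .seq e (.cond_pos (by simpa [h2] using h0) e'), fun i hi => ?_, ?_, ?_⟩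
    · rw [h1' i hi, ← h1 i hi]
    · simp [h0, h2']
    · show t + (t' + 1) ≤ τ γ + (τ₁ γ + (τ₂ γ + 1))
      omega

/-- The context inside of a loop: the register `k` counts the finished rounds, the register `k + 1`
holds the accumulator. -/
def push (c : Ctx Γ) (n : Γ → ℕ) (F : Γ → ℕ → ℕ) (k : ℕ) (hk : c.width ≤ k) :
    Ctx (Iter n) where
  mem x := c.mem x.base
  size x := c.size x.base
  two_le x := c.two_le x.base
  width := k + 2
  holds x ρ := c.holds x.base ρ ∧ ρ k = x.idx ∧ ρ (k + 1) = F x.base x.idx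
  congr x ρ ρ' h := fun ⟨h1, h2, h3⟩ =>
    ⟨c.congr _ _ _ (fun i hi => h i (by omega)) h1, by rw [h k (by omega), h2],
      by rw [h (k + 1) (by omega), h3]⟩

theorem push_over (n : Γ → ℕ) (F : Γ → ℕ → ℕ) (k : ℕ) (hk : c.width ≤ k) :
    (c.push n F k hk).Over c Iter.base :=
  ⟨fun _ => rfl, fun _ => rfl, hk.trans (Nat.le_add_right k 2), fun _ _ h => h.1⟩

theorem comp_idx (n : Γ → ℕ) (F : Γ → ℕ → ℕ) (k : ℕ) (hk : c.width ≤ k) :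
    (c.push n F k hk).Comp Iter.idx :=
  .of_reg k (by simp [push]) fun _ _ h => h.2.1

theorem comp_acc (n : Γ → ℕ) (F : Γ → ℕ → ℕ) (k : ℕ) (hk : c.width ≤ k) :
    (c.push n F k hk).Comp fun x => F x.base x.idx :=
  .of_reg (k + 1) (by simp [push]) fun _ _ h => h.2.2

/-- A loop computes `F` at `n` if its initialization computes `F` at `0` and its body computes `F`
at `i + 1` from `F` at `i`. -/
theorem Comp.loop {F : Γ → ℕ → ℕ} (hn : c.Comp n) (hnp : c.Poly n) (h0 : c.Comp fun γ => F γ 0)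
    (hstep : ∀ (c' : Ctx (Iter n)), c'.Over c Iter.base → c'.Comp Iter.idx →
      (c'.Comp fun x => F x.base x.idx) → c'.Comp fun x => F x.base (x.idx + 1)) :
    c.Comp fun γ => F γ (n γ) := by
  intro k hk
  obtain ⟨p₀, τ₀, hτ₀, hp₀⟩ := h0 (k + 1) (by omega)
  obtain ⟨pn, τn, hτn, hpn⟩ := hn (k + 2) (by omega)
  obtain ⟨pb, τb, ⟨d, hτb⟩, hpb⟩ := hstep _ (push_over n F k hk) (comp_idx n F k hk)
    (comp_acc n F k hk) (k + 4) (by simp [push])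
  refine ⟨.seq p₀ (.seq pn (forLoop k pb)), _,
    hτ₀.add (hτn.add ((hnp.mul ((Poly.size.pow d).add (.const 5))).add (.const 5))),
    fun γ ω s hm hs => ?_⟩
  obtain ⟨ρ₀, t₀, e₀, a₀, b₀, c₀⟩ := hp₀ γ ω s hm hs
  obtain ⟨ρ₁, t₁, e₁, a₁, b₁, c₁⟩ := hpn γ ω { s with reg := ρ₀ } hm
    (c.congr _ _ _ (fun i hi => a₀ i (by omega)) hs)
  obtain ⟨ρ₂, t₂, e₂, a₂, b₂, c₂⟩ := exec_forLoop (ω := ω) (k := k) (n := n γ)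
    (τ := c.size γ ^ d) (p := pb) s (F γ) (fun _ => s.out) (fun i hi ρ r1 r2 r3 => by
      obtain ⟨ρ', t, e, u1, u2, u3⟩ := hpb ⟨(γ, i), hi⟩ ω { s with reg := ρ } hm
        ⟨c.congr _ _ _ (fun j hj => r1 j (by omega)) hs, r2, r3⟩
      exact ⟨ρ', t, e, u1, u2, u3.trans (hτb ⟨(γ, i), hi⟩)⟩) ρ₁
    (fun j hj => by rw [a₁ j (by omega)]; exact a₀ j (by omega))
    (by rw [a₁ _ (by omega)]; exact b₀) b₁
  exact ⟨ρ₂, _, .seq e₀ (.seq e₁ e₂), a₂, b₂, Nat.add_le_add c₀ (Nat.add_le_add c₁ c₂)⟩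

theorem Emits.single (hf : c.Comp f) : c.Emits fun γ => [f γ] := by
  intro k hk
  obtain ⟨p, τ, hτ, hp⟩ := hf k hk
  refine ⟨.seq p (.emit k), _, hτ.add (.const 1), fun γ ω s hm hs => ?_⟩
  obtain ⟨ρ, t, e, h1, h2, h3⟩ := hp γ ω s hm hs
  refine ⟨ρ, _, .seq e ?_, h1, Nat.add_le_add_right h3 1⟩
  have := Exec.emit (ω := ω) { s with reg := ρ } k
  simpa only [h2] using this

theorem Emits.append {l l' : Γ → List ℕ} (hl : c.Emits l) (hl' : c.Emits l') :
    c.Emits fun γ => l γ ++ l' γ := by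
  intro k hk
  obtain ⟨p, τ, hτ, hp⟩ := hl k hk
  obtain ⟨p', τ', hτ', hp'⟩ := hl' k hk
  refine ⟨.seq p p', _, hτ.add hτ', fun γ ω s hm hs => ?_⟩
  obtain ⟨ρ, t, e, h1, h2⟩ := hp γ ω s hm hs
  obtain ⟨ρ', t', e', h1', h2'⟩ := hp' γ ω { s with reg := ρ, out := s.out ++ l γ } hm
    (c.congr _ _ _ (fun i hi => h1 i (by omega)) hs)
  refine ⟨ρ', _, .seq e (by simpa only [List.append_assoc] using e'), fun i hi => ?_,
    Nat.add_le_add h2 h2'⟩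
  rw [h1' i hi, ← h1 i hi]

/-- The loop is run for its output only; its accumulator is constantly zero. -/
theorem Emits.flatMap {l : Γ → ℕ → List ℕ} (hn : c.Comp n) (hnp : c.Poly n)
    (hl : ∀ (c' : Ctx (Iter n)), c'.Over c Iter.base → c'.Comp Iter.idx →
      c'.Emits fun x => l x.base x.idx) :
    c.Emits fun γ => (List.range (n γ)).flatMap (l γ) := by
  intro k hk
  obtain ⟨pn, τn, hτn, hpn⟩ := hn (k + 2) (by omega)
  obtain ⟨pb, τb, ⟨d, hτb⟩, hpb⟩ := hl _ (push_over n (fun _ _ => 0) k hk)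
    (comp_idx n _ k hk) (k + 4) (by simp [push])
  refine ⟨.seq (.const (k + 1) 0) (.seq pn (forLoop k (.seq pb (.const (k + 4) 0)))), _,
    (Poly.const 1).add
      (hτn.add ((hnp.mul (((Poly.size.pow d).add (.const 1)).add (.const 5))).add (.const 5))),
    fun γ ω s hm hs => ?_⟩
  obtain ⟨ρ₁, t₁, e₁, a₁, b₁, c₁⟩ := hpn γ ω (s.setReg (k + 1) 0) hm
    (c.congr _ _ _ (fun i hi => by simp [State.setReg, show i ≠ k + 1 by omega]) hs)
  obtain ⟨ρ₂, t₂, e₂, a₂, b₂, c₂⟩ := exec_forLoop (ω := ω) (k := k) (n := n γ)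
    (τ := c.size γ ^ d + 1) (p := .seq pb (.const (k + 4) 0)) s (fun _ => 0)
    (fun i => s.out ++ (List.range i).flatMap (l γ)) (fun i hi ρ r1 r2 r3 => by
      obtain ⟨ρ', t, e, u1, u2⟩ := hpb ⟨(γ, i), hi⟩ ω
        { s with reg := ρ, out := s.out ++ (List.range i).flatMap (l γ) } hm
        ⟨c.congr _ _ _ (fun j hj => r1 j (by omega)) hs, r2, r3⟩
      have e' : s.out ++ (List.range (i + 1)).flatMap (l γ)
          = s.out ++ (List.range i).flatMap (l γ) ++ l γ i := by
        simp [List.range_succ]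
      rw [e']
      refine ⟨_, _, .seq e (.const _ _ _), fun j hj => ?_, ?_,
        Nat.add_le_add_right (u2.trans (hτb ⟨(γ, i), hi⟩)) 1⟩
      · simp [show j ≠ k + 4 by omega, u1 j hj]
      · simp) ρ₁
    (fun j hj => by rw [a₁ j (by omega)]; simp [State.setReg, show j ≠ k + 1 by omega])
    (by rw [a₁ _ (by omega)]; simp [State.setReg]) b₁
  refine ⟨ρ₂, _, .seq (.const _ _ _) (.seq e₁ ?_), a₂,
    Nat.add_le_add le_rfl (Nat.add_le_add c₁ c₂)⟩
  simpa [State.setReg] using e₂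

/-! ### Arithmetic -/

theorem Comp.sum {g : Γ → ℕ → ℕ} (hn : c.Comp n) (hnp : c.Poly n)
    (hg : ∀ (c' : Ctx (Iter n)), c'.Over c Iter.base → c'.Comp Iter.idx →
      c'.Comp fun x => g x.base x.idx) :
    c.Comp fun γ => ∑ i ∈ Finset.range (n γ), g γ i :=
  .loop (F := fun γ m => ∑ i ∈ Finset.range m, g γ i) hn hnp (by simpa using .const 0)
    fun c' h hi ha => by simpa only [Finset.sum_range_succ] using ha.add (hg c' h hi)

/-- Repeated addition: `g` is the number of rounds, and at unit cost the size of `f` does not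
matter. -/
theorem Comp.mul (hf : c.Comp f) (hg : c.Comp g) (hgp : c.Poly g) :
    c.Comp fun γ => f γ * g γ :=
  (Comp.sum (g := fun γ _ => f γ) hg hgp fun _ h _ => h.comp hf).of_eq fun γ => by
    simp [mul_comm]

theorem Comp.pow (hf : c.Comp f) (hfp : c.Poly f) (hg : c.Comp g) (hgp : c.Poly g) :
    c.Comp fun γ => f γ ^ g γ :=
  .loop (F := fun γ m => f γ ^ m) hg hgp (by simpa using .const 1)
    fun _ h _ ha => by simpa only [pow_succ] using ha.mul (h.comp hf) (h.poly hfp)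

/-- Truncated subtraction decides the order: `1 - (f - g)` is the truth value. -/
theorem Comp.le (hf : c.Comp f) (hg : c.Comp g) :
    c.Comp fun γ => if f γ ≤ g γ then 1 else 0 :=
  ((Comp.const 1).sub (hf.sub hg)).of_eq fun γ => by split_ifs <;> omega

theorem Comp.eq (hf : c.Comp f) (hg : c.Comp g) :
    c.Comp fun γ => if f γ = g γ then 1 else 0 :=
  ((Comp.const 1).sub ((hf.sub hg).add (hg.sub hf))).of_eq fun γ => by split_ifs <;> omega

theorem Comp.ite_prop {P : Γ → Prop} [DecidablePred P]
    (hP : c.Comp fun γ => if P γ then 1 else 0) (hf : c.Comp f) (hg : c.Comp g) :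
    c.Comp fun γ => if P γ then f γ else g γ :=
  (Comp.ite hP hf hg).of_eq fun γ => by by_cases h : P γ <;> simp [h]

theorem Comp.min (hf : c.Comp f) (hg : c.Comp g) : c.Comp fun γ => min (f γ) (g γ) :=
  (hf.sub (hf.sub hg)).of_eq fun γ => by omega

/-- The quotient is found by counting the multiples of `g` up to `f`, at a cost linear in the
dividend. Square roots and logarithms below are counted in the same way. -/
theorem Comp.div (hf : c.Comp f) (hfp : c.Poly f) (hg : c.Comp g) (h0 : ∀ γ, 0 < g γ) :
    c.Comp fun γ => f γ / g γ := by
  refine (Comp.sum (g := fun γ i => if g γ * (i + 1) ≤ f γ then 1 else 0) hf hfp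
    fun c' h hi => ((h.comp hg).mul (hi.add (.const 1))
      ((h.poly_idx hfp).add (.const 1))).le (h.comp hf)).of_eq fun γ => ?_
  rw [Finset.sum_boole, Nat.cast_id]
  have : (Finset.range (f γ)).filter (fun i => g γ * (i + 1) ≤ f γ)
      = Finset.range (f γ / g γ) := by
    ext i
    have h1 : f γ / g γ ≤ f γ := Nat.div_le_self _ _
    have h2 : i < f γ / g γ ↔ g γ * (i + 1) ≤ f γ := by
      rw [← Nat.succ_le_iff, Nat.le_div_iff_mul_le (h0 γ), mul_comm]
    simp only [Finset.mem_filter, Finset.mem_range]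
    omega
  rw [this, Finset.card_range]

theorem Comp.mod (hf : c.Comp f) (hfp : c.Poly f) (hg : c.Comp g) (h0 : ∀ γ, 0 < g γ) :
    c.Comp fun γ => f γ % g γ :=
  (hf.sub (hg.mul (hf.div hfp hg h0) (hfp.mono fun _ => Nat.div_le_self _ _))).of_eq fun γ => by
    have := Nat.div_add_mod (f γ) (g γ)
    omega

theorem Comp.sqrt (hf : c.Comp f) (hfp : c.Poly f) : c.Comp fun γ => Nat.sqrt (f γ) := by
  refine (Comp.sum (g := fun γ i => if (i + 1) * (i + 1) ≤ f γ then 1 else 0) hf hfp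
    fun c' h hi => ((hi.add (.const 1)).mul (hi.add (.const 1))
      ((h.poly_idx hfp).add (.const 1))).le (h.comp hf)).of_eq fun γ => ?_
  rw [Finset.sum_boole, Nat.cast_id]
  have : (Finset.range (f γ)).filter (fun i => (i + 1) * (i + 1) ≤ f γ)
      = Finset.range (Nat.sqrt (f γ)) := by
    ext i
    have h1 := Nat.sqrt_le_self (f γ)
    have h2 : i + 1 ≤ Nat.sqrt (f γ) ↔ (i + 1) * (i + 1) ≤ f γ := Nat.le_sqrt
    simp only [Finset.mem_filter, Finset.mem_range]
    omega
  rw [this, Finset.card_range]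

theorem Comp.log_two (hf : c.Comp f) (hfp : c.Poly f) : c.Comp fun γ => Nat.log 2 (f γ) := by
  refine (Comp.sum (g := fun γ i => if 2 ^ (i + 1) ≤ f γ then 1 else 0) hf hfp
    fun c' h hi => ((Comp.const 2).pow (.const 2) (hi.add (.const 1))
      ((h.poly_idx hfp).add (.const 1))).le (h.comp hf)).of_eq fun γ => ?_
  rw [Finset.sum_boole, Nat.cast_id]
  have : (Finset.range (f γ)).filter (fun i => 2 ^ (i + 1) ≤ f γ)
      = Finset.range (Nat.log 2 (f γ)) := by
    ext i
    have h1 := Nat.log_le_self 2 (f γ)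
    have h2 : f γ ≠ 0 → (i + 1 ≤ Nat.log 2 (f γ) ↔ 2 ^ (i + 1) ≤ f γ) := fun h =>
      Nat.le_log_iff_pow_le Nat.one_lt_two h
    simp only [Finset.mem_filter, Finset.mem_range]
    rcases Nat.eq_zero_or_pos (f γ) with h | h
    · simp [h]
    · have := h2 h.ne'
      omega
  rw [this, Finset.card_range]

end Ctx

end RAM

/-! ### Upper bounds for Littlestone's dimension -/

/-- The class `𝒞` has no mistake tree of depth `d`. -/
def NoMistakeTree {U : Type*} (𝒞 : Set (Set U)) (d : ℕ) : Prop :=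
  ∀ v : (i : Fin d) → (Fin i → Bool) → U, ¬ IsMistakeTree 𝒞 d v

namespace NoMistakeTree

variable {U : Type*} {𝒞 𝒞' : Set (Set U)} {d d' : ℕ}

theorem empty (d : ℕ) : NoMistakeTree (∅ : Set (Set U)) d := fun _ h => by
  obtain ⟨C, hC, -⟩ := h fun _ => false
  exact hC

theorem subset (h : NoMistakeTree 𝒞 d) (hs : 𝒞' ⊆ 𝒞) : NoMistakeTree 𝒞' d := fun v hv =>
  h v fun l => (hv l).imp fun _ hC => ⟨hs hC.1, hC.2⟩

theorem mono (h : NoMistakeTree 𝒞 d) (hd : d ≤ d') : NoMistakeTree 𝒞 d' := fun v hv => by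
  refine h (fun i s => v (Fin.castLE hd i) s) fun l => ?_
  -- A leaf of the truncated tree is extended by arbitrary answers, here `false`.
  obtain ⟨C, hC, hCl⟩ := hv fun i => if hi : i.1 < d then l ⟨i, hi⟩ else false
  refine ⟨C, hC, fun i => ?_⟩
  have := hCl (Fin.castLE hd i)
  simp only [Fin.val_castLE, i.isLt, dite_true] at this
  rw [← this]
  have e : (fun j : Fin i.1 => l (Fin.castLE i.isLt.le j)) = fun j : Fin i.1 =>
      if hi : j.1 < d then l ⟨j, hi⟩ else false := by
    funext j
    simp [j.isLt.trans i.isLt]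
    rfl
  rw [e]

/-- The learner predicts the answer with the smaller bound. -/
theorem succ (h : ∀ x, NoMistakeTree {C ∈ 𝒞 | x ∈ C} d ∨ NoMistakeTree {C ∈ 𝒞 | x ∉ C} d) :
    NoMistakeTree 𝒞 (d + 1) := fun v hv => by
  -- The subtree at the child `b` of the root is a tree for the concepts that give the answer `b` at
  -- the root.
  have key : ∀ b : Bool, ¬ NoMistakeTree {C ∈ 𝒞 | v 0 Fin.elim0 ∈ C ↔ b = true} d := by
    intro b hb
    refine hb (fun i s => v i.succ (Fin.cons b s : Fin (i.1 + 1) → Bool)) fun l => ?_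
    obtain ⟨C, hC, hCl⟩ := hv (Fin.cons b l)
    refine ⟨C, ⟨hC, ?_⟩, fun i => ?_⟩
    · have := hCl 0
      rw [Fin.cons_zero] at this
      rw [← this]
      have e : (Fin.elim0 : Fin 0 → Bool)
          = fun j => (Fin.cons b l : Fin (d + 1) → Bool) (Fin.castLE (Nat.zero_le _) j) := by
        funext j
        exact j.elim0
      rw [e]
      rfl
    · have := hCl i.succ
      rw [Fin.cons_succ] at this
      rw [← this]
      have e : (Fin.cons b (fun j => l (Fin.castLE i.isLt.le j)) : Fin (i.1 + 1) → Bool)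
          = fun j => (Fin.cons b l : Fin (d + 1) → Bool) (Fin.castLE i.succ.isLt.le j) := by
        funext j
        refine Fin.cases ?_ (fun j => ?_) j
        · rfl
        · rfl
      dsimp only
      rw [e]
  rcases h (v 0 Fin.elim0) with h | h
  · exact key true (by simpa using h)
  · exact key false (by simpa using h)

theorem littlestoneDim_le (h : NoMistakeTree 𝒞 (d + 1)) : littlestoneDim 𝒞 ≤ d :=
  csSup_le' fun e ⟨v, hv⟩ => by
    by_contra! hlt
    exact h.mono hlt v hv

end NoMistakeTree

/-! ### A class whose trees have to commit before they are challenged -/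

section Learner

variable {ι X τ σ κ : Type*} {M : ι → Set X} {T : ι → τ} {bit : τ → ℕ → Prop} {W : ι → ℕ → Prop}
  {pr : ι → κ} {cons : κ → ℕ → σ → Prop} {Y N : ℕ}

/-- One of two complementary parts of a set has at most half of its elements. -/
theorem Finset.card_filter_lt_or {α : Type*} {A : Finset α} {u : ℕ} (hA : A.card < 2 ^ (u + 1))
    (p : α → Prop) [DecidablePred p] :
    (A.filter p).card < 2 ^ u ∨ (A.filter fun a => ¬ p a).card < 2 ^ u := by
  have := A.card_filter_add_card_filter_not p
  rw [pow_succ] at hA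
  omega

/-- The form in which `NoMistakeTree.succ` is applied: on one side of the query, the surviving
indices only have to be contained in a set whose bound is known. An empty set there expresses that
this answer is impossible. -/
theorem NoMistakeTree.or_of_image {V : Set ι} {d : ℕ} {x : X} {V₁ V₀ : Set ι}
    (h : NoMistakeTree (M '' V₁) d ∧ (∀ c ∈ V, x ∈ M c → c ∈ V₁) ∨
      NoMistakeTree (M '' V₀) d ∧ (∀ c ∈ V, x ∉ M c → c ∈ V₀)) :
    NoMistakeTree {C ∈ M '' V | x ∈ C} d ∨ NoMistakeTree {C ∈ M '' V | x ∉ C} d := by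
  rcases h with h | h
  · left
    refine h.1.subset ?_
    rintro _ ⟨⟨c, hc, rfl⟩, hx⟩
    exact ⟨c, h.2 c hc hx, rfl⟩
  · right
    refine h.1.subset ?_
    rintro _ ⟨⟨c, hc, rfl⟩, hx⟩
    exact ⟨c, h.2 c hc hx, rfl⟩

theorem NoMistakeTree.of_isEmpty {V : Set ι} (hV : ∀ c, c ∉ V) (d : ℕ) :
    NoMistakeTree (M '' V) d := by
  rw [Set.eq_empty_of_forall_notMem hV, Set.image_empty]
  exact .empty d

/-- The game after `T` is known: every mistake halves the set of candidates, or is one of the less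
than `N` places where `W` agrees with the target `z`. -/
theorem noMistakeTree_challenge
    (hX : ∀ x, (∃ t < Y, ∃ s, ∀ c, x ∈ M c ↔ bit (T c) t ∧ cons (pr c) t s) ∨
      ∃ θ, ∃ t < Y, ∀ c, x ∈ M c ↔ T c = θ ∧ W c t)
    (θ : τ) (z : ℕ → Prop) (F : Set ι) [∀ c, DecidablePred fun t => (W c t ↔ z t)]
    (hF : ∀ c ∈ F, ((Finset.range Y).filter fun t => (W c t ↔ z t)).card < N)
    (k : ℕ) : ∀ (A : Finset κ) (Q : Finset ℕ) (u w : ℕ), u + w = k → A.card < 2 ^ u →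
      Q ⊆ Finset.range Y → N ≤ Q.card + w →
      NoMistakeTree (M '' {c | c ∈ F ∧ T c = θ ∧ pr c ∈ A ∧ ∀ t ∈ Q, (W c t ↔ z t)}) k := by
  classical
  induction k with
  | zero =>
    intro A Q u w hk hA _ _
    refine .of_isEmpty ?_ _
    rintro c ⟨-, -, h, -⟩
    rw [show u = 0 by omega] at hA
    have := Finset.card_pos.2 ⟨_, h⟩
    omega
  | succ k ih =>
    intro A Q u w hk hA hQ hN
    obtain _ | u := u
    · refine .of_isEmpty ?_ _
      rintro c ⟨-, -, h, -⟩
      have := Finset.card_pos.2 ⟨_, h⟩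
      omega
    -- With `w = 0` the set `Q` has at least `N` places of agreement, more than any concept in `F`
    -- admits.
    obtain _ | w := w
    · refine .of_isEmpty ?_ _
      rintro c ⟨h, -, -, h'⟩
      have h1 := hF c h
      have h2 : Q ⊆ (Finset.range Y).filter fun t => (W c t ↔ z t) := fun t ht =>
        Finset.mem_filter.2 ⟨hQ ht, h' t ht⟩
      have := Finset.card_le_card h2
      omega
    refine .succ fun x => ?_
    rcases hX x with ⟨t, -, s, hx⟩ | ⟨θ', t, ht, hx⟩
    -- Since `T = θ` is known, a commitment at a place with bit zero has a known answer; at the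
    -- other places the majority of the candidates decides.
    · by_cases hb : bit θ t
      · refine NoMistakeTree.or_of_image ((Finset.card_filter_lt_or hA fun a => cons a t s).imp
          (fun h => ⟨ih _ Q u (w + 1) (by omega) h hQ hN, ?_⟩)
          (fun h => ⟨ih _ Q u (w + 1) (by omega) h hQ hN, ?_⟩))
        · rintro c ⟨h1, h2, h3, h4⟩ hc
          exact ⟨h1, h2, Finset.mem_filter.2 ⟨h3, ((hx c).1 hc).2⟩, h4⟩
        · rintro c ⟨h1, h2, h3, h4⟩ hc
          exact ⟨h1, h2, Finset.mem_filter.2 ⟨h3, fun h => hc ((hx c).2 ⟨h2 ▸ hb, h⟩)⟩, h4⟩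
      · refine NoMistakeTree.or_of_image (V₁ := ∅) (V₀ := ∅) (.inl ⟨.of_isEmpty (by simp) _, ?_⟩)
        rintro c ⟨-, h2, -⟩ hc
        exact hb (h2 ▸ ((hx c).1 hc).1)
    · by_cases hθ : θ = θ'
      · by_cases htQ : t ∈ Q
        · by_cases hz : z t
          · refine NoMistakeTree.or_of_image (V₁ := ∅) (V₀ := ∅) (.inr ⟨.of_isEmpty (by simp) _, ?_⟩)
            rintro c ⟨-, h2, -, h4⟩ hc
            exact hc ((hx c).2 ⟨h2.trans hθ, (h4 t htQ).2 hz⟩)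
          · refine NoMistakeTree.or_of_image (V₁ := ∅) (V₀ := ∅) (.inl ⟨.of_isEmpty (by simp) _, ?_⟩)
            rintro c ⟨-, h2, -, h4⟩ hc
            exact hz ((h4 t htQ).1 ((hx c).1 hc).2)
        -- The learner predicts the opposite of `z t`, so a mistake puts `t` into the set of
        -- agreements.
        · have hI := ih A (insert t Q) (u + 1) w (by omega) hA
            (Finset.insert_subset (Finset.mem_range.2 ht) hQ)
            (by rw [Finset.card_insert_of_notMem htQ]; omega)
          by_cases hz : z t
          · refine NoMistakeTree.or_of_image (V₀ := ∅) (.inl ⟨hI, ?_⟩)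
            rintro c ⟨h1, h2, h3, h4⟩ hc
            exact ⟨h1, h2, h3, Finset.forall_mem_insert _ _ _ |>.2
              ⟨iff_of_true ((hx c).1 hc).2 hz, h4⟩⟩
          · refine NoMistakeTree.or_of_image (V₁ := ∅) (.inr ⟨hI, ?_⟩)
            rintro c ⟨h1, h2, h3, h4⟩ hc
            exact ⟨h1, h2, h3, Finset.forall_mem_insert _ _ _ |>.2
              ⟨iff_of_false (fun h => hc ((hx c).2 ⟨h2.trans hθ, h⟩)) hz, h4⟩⟩
      · refine NoMistakeTree.or_of_image (V₁ := ∅) (V₀ := ∅) (.inl ⟨.of_isEmpty (by simp) _, ?_⟩)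
        rintro c ⟨-, h2, -⟩ hc
        exact hθ (h2.symm.trans ((hx c).1 hc).1)

/-- The whole game: before `T` is known, every mistake halves the set of candidates, or commits the
adversary at a new place `t < Y`. -/
theorem noMistakeTree_commit
    (hX : ∀ x, (∃ t < Y, ∃ s, ∀ c, x ∈ M c ↔ bit (T c) t ∧ cons (pr c) t s) ∨
      ∃ θ, ∃ t < Y, ∀ c, x ∈ M c ↔ T c = θ ∧ W c t)
    (hN : Y < 2 * N)
    (hU : ∀ m ⊆ Finset.range Y, Y ≤ 2 * m.card → ∀ s : ℕ → σ, ∃ z : ℕ → Prop,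
      ∃ _ : ∀ c, DecidablePred fun t => (W c t ↔ z t), ∀ c, (∀ t ∈ m, cons (pr c) t (s t)) →
        ((Finset.range Y).filter fun t => (W c t ↔ z t)).card < N)
    (k : ℕ) : ∀ (A : Finset κ) (m : Finset ℕ) (s : ℕ → σ) (u w : ℕ), u + w = k → A.card < 2 ^ u →
      m ⊆ Finset.range Y → m.card + w = Y →
      NoMistakeTree
        (M '' {c | pr c ∈ A ∧ ∀ t ∈ m, bit (T c) t ∧ cons (pr c) t (s t)}) (k + N + 1) := by
  classical
  induction k with
  | zero =>
    intro A Q s u w hk hA _ _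
    refine .of_isEmpty ?_ _
    rintro c ⟨h, -⟩
    rw [show u = 0 by omega] at hA
    have := Finset.card_pos.2 ⟨_, h⟩
    omega
  | succ k ih =>
    intro A m s u w hk hA hm hw
    refine .succ fun x => ?_
    rcases hX x with ⟨t, ht, σ', hx⟩ | ⟨θ, t, ht, hx⟩
    · rw [show k + 1 + N = k + N + 1 by omega]
      by_cases htm : t ∈ m
      · obtain _ | u := u
        · refine .inl (.subset (.empty _) ?_)
          rintro _ ⟨⟨c, ⟨h, -⟩, rfl⟩, -⟩
          have := Finset.card_pos.2 ⟨_, h⟩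
          omega
        refine NoMistakeTree.or_of_image ((Finset.card_filter_lt_or hA fun a => cons a t σ').imp
          (fun h => ⟨ih _ m s u w (by omega) h hm hw, ?_⟩)
          (fun h => ⟨ih _ m s u w (by omega) h hm hw, ?_⟩))
        · rintro c ⟨h1, h2⟩ hc
          exact ⟨Finset.mem_filter.2 ⟨h1, ((hx c).1 hc).2⟩, h2⟩
        · rintro c ⟨h1, h2⟩ hc
          exact ⟨Finset.mem_filter.2 ⟨h1, fun h => hc ((hx c).2 ⟨(h2 t htm).1, h⟩)⟩, h2⟩
      -- At a new place the prediction is non-membership; a mistake sets the bit of `T` there and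
      -- commits the adversary to the label `σ'`.
      · have hm' := Finset.insert_subset (Finset.mem_range.2 ht) hm
        have hc := Finset.card_le_card hm'
        rw [Finset.card_insert_of_notMem htm, Finset.card_range] at hc
        refine NoMistakeTree.or_of_image (V₀ := ∅) (.inl ⟨ih A (insert t m) (Function.update s t σ') u (w - 1)
          (by omega) hA hm' (by rw [Finset.card_insert_of_notMem htm]; omega), ?_⟩)
        rintro c ⟨h1, h2⟩ hc
        refine ⟨h1, fun t' ht' => ?_⟩
        rcases Finset.mem_insert.1 ht' with rfl | ht'
        · simpa using (hx c).1 hc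
        · have : t' ≠ t := fun h => htm (h ▸ ht')
          simpa [this] using h2 t' ht'
    -- A mistake on a challenge reveals `T = θ`, and the second game starts with whatever budget is
    -- left.
    · by_cases hY : Y ≤ 2 * m.card
      · obtain ⟨z, hd, hz⟩ := hU m hm hY s
        refine NoMistakeTree.or_of_image (V₀ := ∅) (.inl ⟨(noMistakeTree_challenge hX θ z
          {c | ∀ t ∈ m, cons (pr c) t (s t)} hz (u + N) A ∅ u N rfl hA (by simp)
          (by simp)).mono (by omega), ?_⟩)
        rintro c ⟨h1, h2⟩ hc
        exact ⟨fun t ht => (h2 t ht).2, ((hx c).1 hc).1, h1, by simp⟩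
      -- With few commitments the trivial bound by all `Y` places is affordable: `2 |m| < Y < 2 N`
      -- gives `u + Y + 1 ≤ u + (Y - |m|) + N`.
      · refine NoMistakeTree.or_of_image (V₀ := ∅) (.inl ⟨(noMistakeTree_challenge (N := Y + 1) hX θ
          (fun _ => True) Set.univ (fun c _ => ?_) (u + (Y + 1)) A ∅ u (Y + 1) rfl hA (by simp)
          (by simp)).mono (by omega), ?_⟩)
        · exact Nat.lt_succ_of_le ((Finset.card_filter_le _ _).trans (Finset.card_range Y).le)
        · rintro c ⟨h1, h2⟩ hc
          exact ⟨trivial, ((hx c).1 hc).1, h1, by simp⟩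

end Learner

/-! ### Digits and the Hadamard code -/

/-- The digit of `x` at the position `p` in base `q`. -/
def digitAt (q x p : ℕ) : ℕ := x / q ^ p % q

theorem exists_digitAt {q : ℕ} (f : ℕ → ℕ) (hf : ∀ p, f p < q) (H : ℕ) :
    ∃ x < q ^ H, ∀ p < H, digitAt q x p = f p := by
  induction H with
  | zero => exact ⟨0, by simp, by simp⟩
  | succ H ih =>
    obtain ⟨x, hx, h⟩ := ih
    have hq : 0 < q := (Nat.zero_le _).trans_lt (hf 0)
    refine ⟨x + q ^ H * f H, ?_, fun p hp => ?_⟩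
    · have := Nat.mul_le_mul_left (q ^ H) (Nat.succ_le_of_lt (hf H))
      rw [Nat.mul_succ] at this
      rw [pow_succ]
      omega
    · rcases Nat.lt_succ_iff_lt_or_eq.1 hp with hp | rfl
      · rw [← h p hp]
        have : q ^ H = q ^ p * (q * q ^ (H - p - 1)) := by
          rw [← pow_succ', ← pow_add]
          congr 1
          omega
        rw [digitAt, digitAt, this, mul_assoc, Nat.add_mul_div_left _ _ (pow_pos hq _), mul_assoc,
          Nat.add_mul_mod_self_left]
      · rw [digitAt, Nat.add_mul_div_left _ _ (pow_pos hq _), Nat.div_eq_of_lt hx, zero_add,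
          Nat.mod_eq_of_lt (hf p)]

theorem digitAt_two (x p : ℕ) : digitAt 2 x p = (x.testBit p).toNat :=
  (Nat.toNat_testBit x p).symm

/-- The entry at `t` of the code word of `i`: the inner product of `i` and `t` as bit vectors. -/
def hadamard (R i t : ℕ) : ℕ := (∑ p ∈ Finset.range R, digitAt 2 i p * digitAt 2 t p) % 2

/-- Flipping bit `p` of `t` changes only the summand at `p`, by the corresponding bit of `i`. -/
theorem hadamard_xor {R i p : ℕ} (hp : p < R) (t : ℕ) :
    hadamard R i (t ^^^ 2 ^ p) = (hadamard R i t + digitAt 2 i p) % 2 := by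
  have h1 : ∀ f : ℕ → ℕ, ∑ r ∈ Finset.range R, f r
      = f p + ∑ r ∈ (Finset.range R).erase p, f r := fun f =>
    (Finset.add_sum_erase _ f (Finset.mem_range.2 hp)).symm
  have h2 : ∑ r ∈ (Finset.range R).erase p, digitAt 2 i r * digitAt 2 (t ^^^ 2 ^ p) r
      = ∑ r ∈ (Finset.range R).erase p, digitAt 2 i r * digitAt 2 t r := by
    refine Finset.sum_congr rfl fun r hr => ?_
    have : p ≠ r := (Finset.ne_of_mem_erase hr).symm
    simp [digitAt_two, Nat.testBit_xor, this]
  rw [hadamard, hadamard, h1, h1 fun r => digitAt 2 i r * digitAt 2 t r, h2]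
  simp only [digitAt_two, Nat.testBit_xor, Nat.testBit_two_pow_self]
  cases i.testBit p <;> cases t.testBit p <;> simp <;> omega

/-- The bound `2 ^ p < R` keeps short the blocks on which the flip of bit `p` acts. -/
theorem exists_digitAt_ne {i j R : ℕ} (hi : i < R) (hj : j < R) (hij : i ≠ j) :
    ∃ p, digitAt 2 i p ≠ digitAt 2 j p ∧ 2 ^ p < R := by
  obtain ⟨p, hp⟩ := Nat.exists_testBit_ne_of_ne hij
  refine ⟨p, ?_, ?_⟩
  · simp only [digitAt_two]
    cases h : i.testBit p <;> cases h' : j.testBit p <;> simp_all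
  · by_contra! h
    rw [Nat.testBit_lt_two_pow (hi.trans_le h), Nat.testBit_lt_two_pow (hj.trans_le h)] at hp
    exact hp rfl

/-- Any two code words differ in about half of the places. -/
theorem card_hadamard_ne {i j R : ℕ} (hi : i < R) (hj : j < R) (hij : i ≠ j) (Y : ℕ) :
    Y ≤ 2 * ((Finset.range Y).filter fun t => hadamard R i t ≠ hadamard R j t).card + 2 * R := by
  obtain ⟨p, hp, hpR⟩ := exists_digitAt_ne hi hj hij
  obtain ⟨P, hP⟩ : ∃ P, P = 2 ^ (p + 1) := ⟨_, rfl⟩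
  have hP0 : 0 < P := hP ▸ by positivity
  have hPR : P < 2 * R := by
    rw [hP, pow_succ]
    omega
  set K := Y / P
  have hflip : ∀ t, hadamard R i (t ^^^ 2 ^ p) ≠ hadamard R j (t ^^^ 2 ^ p) ↔
      ¬ hadamard R i t ≠ hadamard R j t := by
    intro t
    have h1 := hadamard_xor (i := i) (Nat.lt_two_pow_self.trans hpR) t
    have h2 := hadamard_xor (i := j) (Nat.lt_two_pow_self.trans hpR) t
    have h3 : hadamard R i t < 2 := Nat.mod_lt _ two_pos
    have h4 : hadamard R j t < 2 := Nat.mod_lt _ two_pos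
    have h5 : digitAt 2 i p < 2 := Nat.mod_lt _ two_pos
    have h6 : digitAt 2 j p < 2 := Nat.mod_lt _ two_pos
    omega
  -- The flip stays within aligned blocks of length `P = 2 ^ (p + 1)`, hence permutes the first `P *
  -- K` places. It exchanges agreement and disagreement, so exactly half of these places disagree;
  -- fewer than `2 R` places are left over.
  have hlt : ∀ t, t ^^^ 2 ^ p < P * K ↔ t < P * K := by
    intro t
    have : (t ^^^ 2 ^ p) / P = t / P := by
      rw [hP, ← Nat.shiftRight_eq_div_pow, Nat.shiftRight_xor_distrib, Nat.shiftRight_eq_div_pow,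
        Nat.shiftRight_eq_div_pow, Nat.div_eq_of_lt (Nat.pow_lt_pow_right one_lt_two p.lt_succ_self),
        Nat.xor_zero]
    rw [mul_comm, ← Nat.div_lt_iff_lt_mul hP0, this,
      Nat.div_lt_iff_lt_mul hP0]
  set D := (Finset.range (P * K)).filter fun t => hadamard R i t ≠ hadamard R j t
    with hD
  have h1 : D.card = ((Finset.range (P * K)).filter
      fun t => ¬ hadamard R i t ≠ hadamard R j t).card := by
    refine Finset.card_nbij' (· ^^^ 2 ^ p) (· ^^^ 2 ^ p) ?_ ?_ ?_ ?_
    · intro t ht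
      simp only [hD, Finset.coe_filter, Finset.mem_range, Set.mem_ofPred_eq, hlt, hflip] at ht ⊢
      exact ⟨ht.1, not_not.2 ht.2⟩
    · intro t ht
      simp only [hD, Finset.coe_filter, Finset.mem_range, Set.mem_ofPred_eq, hlt, hflip] at ht ⊢
      exact ht
    · intro t _
      simp
    · intro t _
      simp
  have h2 := Finset.card_filter_add_card_filter_not (s := Finset.range (P * K))
    fun t => hadamard R i t ≠ hadamard R j t
  rw [Finset.card_range, ← h1] at h2
  have h3 : P * K + Y % P = Y := Nat.div_add_mod Y P
  have h4 := Nat.mod_lt Y hP0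
  have h5 : D.card ≤ ((Finset.range Y).filter
      fun t => hadamard R i t ≠ hadamard R j t).card := by
    refine Finset.card_le_card (Finset.filter_subset_filter _ ?_)
    intro t ht
    rw [Finset.mem_range] at ht ⊢
    omega
  change D.card + D.card = _ at h2
  omega

/-- The distance of the bit string `W` of length `Y` from the code word of `i`. -/
def codeDist (R Y W i : ℕ) : ℕ :=
  ∑ t ∈ Finset.range Y, if digitAt 2 W t = hadamard R i t then 0 else 1

/-- The index of a code word close to `W`. -/
def decode (R Y W : ℕ) : ℕ :=
  (∑ i ∈ Finset.range R, if 5 * codeDist R Y W i + 1 ≤ Y then i else 0) % R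

theorem codeDist_eq_card (R Y W i : ℕ) : codeDist R Y W i
    = ((Finset.range Y).filter fun t => digitAt 2 W t ≠ hadamard R i t).card := by
  rw [codeDist, Finset.card_filter]
  refine Finset.sum_congr rfl fun t _ => ?_
  by_cases h : digitAt 2 W t = hadamard R i t <;> simp [h]

/-- The distance of two code words is at least `Y / 2 - R ≥ 0.45 Y`, more than twice the radius `Y /
5`. So the sum in `decode` has at most one nonzero term, and it equals `i`. -/
theorem decode_eq {R Y W i : ℕ} (hY : 20 * R ≤ Y) (hi : i < R) (h : 5 * codeDist R Y W i < Y) :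
    decode R Y W = i := by
  have huniq : ∀ j ∈ Finset.range R, j ≠ i →
      (if 5 * codeDist R Y W j + 1 ≤ Y then j else 0) = 0 := by
    intro j hj hji
    refine if_neg fun hlt => ?_
    have h1 := card_hadamard_ne (Finset.mem_range.1 hj) hi hji Y
    have h2 : ((Finset.range Y).filter fun t => hadamard R j t ≠ hadamard R i t).card
        ≤ codeDist R Y W j + codeDist R Y W i := by
      rw [codeDist_eq_card, codeDist_eq_card]
      refine (Finset.card_le_card fun t ht => ?_).trans (Finset.card_union_le _ _)
      simp only [Finset.mem_union, Finset.mem_filter] at ht ⊢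
      by_cases e : digitAt 2 W t = hadamard R j t
      · exact .inr ⟨ht.1, e ▸ ht.2⟩
      · exact .inl ⟨ht.1, e⟩
    omega
  rw [decode, Finset.sum_eq_single_of_mem i (Finset.mem_range.2 hi) huniq,
    if_pos (show 5 * codeDist R Y W i + 1 ≤ Y from h),
    Nat.mod_eq_of_lt hi]

/-- A string that does not decode to `i` lies outside of the ball of radius `Y / 5` around the code
word of `i`. -/
theorem card_agree_lt {R Y W i : ℕ} (hY : 20 * R ≤ Y) (hi : i < R) (h : decode R Y W ≠ i) :
    ((Finset.range Y).filter fun t => (digitAt 2 W t = 1 ↔ hadamard R i t = 1)).card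
      < 4 * Y / 5 + 1 := by
  have h1 : Y ≤ 5 * codeDist R Y W i := by
    by_contra! hlt
    exact h (decode_eq hY hi hlt)
  have h2 := Finset.card_filter_add_card_filter_not (s := Finset.range Y)
    fun t => digitAt 2 W t = hadamard R i t
  rw [Finset.card_range] at h2
  have h3 : ((Finset.range Y).filter fun t => (digitAt 2 W t = 1 ↔ hadamard R i t = 1))
      = (Finset.range Y).filter fun t => digitAt 2 W t = hadamard R i t := by
    refine Finset.filter_congr fun t _ => ?_
    have h3 : hadamard R i t < 2 := Nat.mod_lt _ two_pos
    have h4 : digitAt 2 W t < 2 := Nat.mod_lt _ two_pos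
    omega
  rw [codeDist_eq_card] at h1
  change _ + (Finset.filter (fun t => digitAt 2 W t ≠ hadamard R i t) _).card = _ at h2
  rw [h3]
  omega

/-! ### The concept class of a Label Cover instance -/

/-- A Label Cover instance with `m` edges and alphabet size `q`, the vertices of whose sides are
split into `R` and `RB` blocks of at most `H` vertices according to their residues, and a number of
rounds `Y`. -/
structure Layout where
  (q m R RB H Y : ℕ)
  (src tgt : ℕ → ℕ)
  proj : ℕ → ℕ → ℕ

namespace Layout

/-- The number of edges between the block `i` with labels `α` and the block of `t` with labels `σ`
that are not satisfied. -/
def viol (l : Layout) (i α t σ : ℕ) : ℕ :=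
  ∑ e ∈ Finset.range l.m, if l.src e % l.R = i then
    if l.tgt e % l.RB = t % l.RB then
      if l.proj e (digitAt l.q α (l.src e / l.R)) = digitAt l.q σ (l.tgt e / l.RB) then 0 else 1
    else 0
  else 0

theorem viol_eq_zero {l : Layout} {i α t σ : ℕ} : l.viol i α t σ = 0 ↔
    ∀ e < l.m, l.src e % l.R = i → l.tgt e % l.RB = t % l.RB →
      l.proj e (digitAt l.q α (l.src e / l.R)) = digitAt l.q σ (l.tgt e / l.RB) := by
  simp only [viol, Finset.sum_eq_zero_iff, Finset.mem_range]
  refine forall₂_congr fun e _ => ?_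
  split_ifs <;> simp_all

/-- The number of ground elements: challenges, followed by commitments. -/
def numElems (l : Layout) : ℕ := 2 ^ l.Y * l.Y + l.q ^ l.H * l.Y

/-- The number of concepts. A concept consists of an answer to the commitments, an answer to the
challenges, and labels for the block that the latter select. -/
def numConcepts (l : Layout) : ℕ := 2 ^ l.Y * (2 ^ l.Y * l.q ^ l.H)

/-- The entries of the incidence matrix. -/
def entry (l : Layout) (c x : ℕ) : ℕ :=
  if 2 ^ l.Y * l.Y ≤ x then
    if digitAt 2 (c % 2 ^ l.Y) ((x - 2 ^ l.Y * l.Y) % l.Y) = 1 then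
      if l.viol (decode l.R l.Y (c / 2 ^ l.Y % 2 ^ l.Y)) (c / 2 ^ l.Y / 2 ^ l.Y)
        ((x - 2 ^ l.Y * l.Y) % l.Y) ((x - 2 ^ l.Y * l.Y) / l.Y) = 0 then 1 else 0
    else 0
  else if x / l.Y = c % 2 ^ l.Y then digitAt 2 (c / 2 ^ l.Y % 2 ^ l.Y) (x % l.Y) else 0

/-- The table of the concept class. -/
def table (l : Layout) : ConceptTable where
  numElems := l.numElems
  numConcepts := l.numConcepts
  mem c x := decide (l.entry c x = 1)

variable {l : Layout}

theorem finite_conceptClass (D : ConceptTable) : D.conceptClass.Finite := Set.finite_range _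

theorem entry_challenge (hY : 0 < l.Y) (c : ℕ) {θ t : ℕ} (hθ : θ < 2 ^ l.Y) (ht : t < l.Y) :
    l.entry c (l.Y * θ + t) = 1 ↔
      c % 2 ^ l.Y = θ ∧ digitAt 2 (c / 2 ^ l.Y % 2 ^ l.Y) t = 1 := by
  have h1 : ¬ 2 ^ l.Y * l.Y ≤ l.Y * θ + t := by
    have := Nat.mul_le_mul_left l.Y (Nat.succ_le_of_lt hθ)
    rw [Nat.mul_succ, mul_comm l.Y (2 ^ l.Y)] at this
    omega
  have h2 : (l.Y * θ + t) / l.Y = θ := by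
    rw [Nat.mul_add_div hY, Nat.div_eq_of_lt ht, add_zero]
  rw [entry, if_neg h1, h2, Nat.mul_add_mod, Nat.mod_eq_of_lt ht]
  by_cases h : θ = c % 2 ^ l.Y
  · simp [h]
  · simp [h, Ne.symm h]

theorem entry_commit (hY : 0 < l.Y) (c σ : ℕ) {t : ℕ} (ht : t < l.Y) :
    l.entry c (2 ^ l.Y * l.Y + (l.Y * σ + t)) = 1 ↔ digitAt 2 (c % 2 ^ l.Y) t = 1 ∧
      l.viol (decode l.R l.Y (c / 2 ^ l.Y % 2 ^ l.Y)) (c / 2 ^ l.Y / 2 ^ l.Y) t σ = 0 := by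
  have h2 : (l.Y * σ + t) / l.Y = σ := by
    rw [Nat.mul_add_div hY, Nat.div_eq_of_lt ht, add_zero]
  rw [entry, if_pos (Nat.le_add_right _ _), Nat.add_sub_cancel_left, h2, Nat.mul_add_mod,
    Nat.mod_eq_of_lt ht]
  split_ifs <;> simp_all

/-- The labels committed to are those of `g`, and the block of `A` is labelled by `f` only after the
answers have selected it; the edges between are satisfied in every case. -/
theorem le_littlestoneDim (hY : 0 < l.Y) (f g : ℕ → ℕ) (hf : ∀ u, f u < l.q)
    (hg : ∀ u, g u < l.q) (hsrc : ∀ e < l.m, l.src e / l.R < l.H)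
    (htgt : ∀ e < l.m, l.tgt e / l.RB < l.H)
    (hsat : ∀ e < l.m, l.proj e (f (l.src e)) = g (l.tgt e)) :
    2 * l.Y ≤ littlestoneDim l.table.conceptClass := by
  choose A hA hAd using fun i => exists_digitAt (fun p => f (l.R * p + i)) (fun _ => hf _) l.H
  choose S hS hSd using fun j => exists_digitAt (fun p => g (l.RB * p + j)) (fun _ => hg _) l.H
  choose B hB hBd using fun b : ℕ → Bool =>
    exists_digitAt (fun p => (b p).toNat) (fun p => Bool.toNat_lt (b p)) l.Y
  have hx1 : ∀ i < l.Y, 2 ^ l.Y * l.Y + (l.Y * S (i % l.RB) + i) < l.numElems := by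
    intro i hi
    have := Nat.mul_le_mul_left l.Y (Nat.succ_le_of_lt (hS (i % l.RB)))
    rw [Nat.mul_succ, mul_comm l.Y (l.q ^ l.H)] at this
    rw [numElems]
    omega
  have hx2 : ∀ i < l.Y, ∀ b, l.Y * B b + i < l.numElems := by
    intro i hi b
    have := Nat.mul_le_mul_left l.Y (Nat.succ_le_of_lt (hB b))
    rw [Nat.mul_succ, mul_comm l.Y (2 ^ l.Y)] at this
    rw [numElems]
    omega
  -- In the second half the challenge quotes the first `Y` answers as its `θ`. The condition `p <
  -- i.1` is automatic there, and the default `false` is never read within the first `Y` digits.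
  let node : (i : Fin (2 * l.Y)) → (Fin i → Bool) → ℕ := fun i s =>
    if i.1 < l.Y then 2 ^ l.Y * l.Y + (l.Y * S (i.1 % l.RB) + i.1) else
      l.Y * B (fun p => if hp : p < l.Y ∧ p < i.1 then s ⟨p, hp.2⟩ else false) + (i.1 - l.Y)
  have hnode : ∀ i s, node i s < l.table.numElems := by
    intro i s
    by_cases hi : i.1 < l.Y
    · exact (if_pos hi).trans_lt (hx1 i.1 hi)
    · exact (if_neg hi).trans_lt (hx2 (i.1 - l.Y) (by omega) _)
  refine le_csSup (bddAbove_mistakeTree (finite_conceptClass _))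
    ⟨fun i s => ⟨node i s, hnode i s⟩, fun L => ?_⟩
  set bT : ℕ → Bool := fun p => if hp : p < l.Y then L ⟨p, by omega⟩ else false with hbT
  set bW : ℕ → Bool := fun p => if hp : p < l.Y then L ⟨p + l.Y, by omega⟩ else false with hbW
  -- The concept at the leaf: the two halves of the path, and the labels under `f` of the block that
  -- the second half selects.
  obtain ⟨a, ha⟩ : ∃ a, a = A (decode l.R l.Y (B bW)) := ⟨_, rfl⟩
  have hc : B bT + 2 ^ l.Y * (B bW + 2 ^ l.Y * a) < l.numConcepts := by
    have h1 := Nat.mul_le_mul_left (2 ^ l.Y) (Nat.succ_le_of_lt (ha ▸ hA (decode l.R l.Y (B bW)) : a < _))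
    have h2 : B bW + 2 ^ l.Y * a < 2 ^ l.Y * l.q ^ l.H := by
      have := hB bW
      rw [Nat.mul_succ] at h1
      omega
    have h3 := Nat.mul_le_mul_left (2 ^ l.Y) (Nat.succ_le_of_lt h2)
    have := hB bT
    rw [Nat.mul_succ] at h3
    rw [numConcepts]
    omega
  have e1 : (B bT + 2 ^ l.Y * (B bW + 2 ^ l.Y * a)) % 2 ^ l.Y = B bT := by
    rw [Nat.add_mul_mod_self_left, Nat.mod_eq_of_lt (hB bT)]
  have e2 : (B bT + 2 ^ l.Y * (B bW + 2 ^ l.Y * a)) / 2 ^ l.Y = B bW + 2 ^ l.Y * a := by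
    rw [Nat.add_mul_div_left _ _ (by positivity), Nat.div_eq_of_lt (hB bT), zero_add]
  have e3 : (B bW + 2 ^ l.Y * a) % 2 ^ l.Y = B bW := by
    rw [Nat.add_mul_mod_self_left, Nat.mod_eq_of_lt (hB bW)]
  have e4 : (B bW + 2 ^ l.Y * a) / 2 ^ l.Y = a := by
    rw [Nat.add_mul_div_left _ _ (by positivity), Nat.div_eq_of_lt (hB bW), zero_add]
  refine ⟨_, ⟨⟨_, hc⟩, rfl⟩, fun i => ?_⟩
  refine decide_eq_true_iff.trans ?_
  change l.entry (B bT + 2 ^ l.Y * (B bW + 2 ^ l.Y * a))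
    (node i fun j => L (Fin.castLE i.isLt.le j)) = 1 ↔ _
  by_cases hi : i.1 < l.Y
  · rw [show node i (fun j => L (Fin.castLE i.isLt.le j)) = _ from if_pos hi,
      entry_commit hY _ _ hi, e1, e2, e3, e4, hBd bT _ hi]
    have hv : l.viol (decode l.R l.Y (B bW)) a i.1 (S (i.1 % l.RB)) = 0 := by
      rw [viol_eq_zero]
      intro e he h1 h2
      rw [ha, hAd _ _ (hsrc e he), hSd _ _ (htgt e he), ← h1, ← h2, Nat.div_add_mod,
        Nat.div_add_mod, hsat e he]
    simp [hv, hbT, hi]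
  · have hi' : i.1 - l.Y < l.Y := by omega
    rw [show node i (fun j => L (Fin.castLE i.isLt.le j)) = _ from if_neg hi]
    have hb : (fun p => if hp : p < l.Y ∧ p < i.1 then L (Fin.castLE i.isLt.le ⟨p, hp.2⟩)
        else false) = bT := by
      funext p
      by_cases hp : p < l.Y
      · have : p < i.1 := by omega
        simp [hbT, hp, this]
      · simp [hbT, hp]
    rw [hb, entry_challenge hY _ (hB bT) hi', e1, e2, e3, hBd bW _ hi']
    have : i.1 - l.Y + l.Y = i.1 := by omega
    simp [hbW, hi', this]

/-- The commitment game starts with the `R * q ^ H` pairs of a block and its labels as candidates.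
The final reduction modulo `R` in `decode` ensures that every string, even one far from the code,
selects one of the `R` blocks. -/
theorem littlestoneDim_le (hR : 0 < l.R) (hRY : 20 * l.R ≤ l.Y) {u : ℕ}
    (hu : l.R * l.q ^ l.H < 2 ^ u)
    (hU : ∀ m ⊆ Finset.range l.Y, l.Y ≤ 2 * m.card → ∀ s : ℕ → ℕ,
      ∃ i < l.R, ∀ α, ∃ t ∈ m, l.viol i α t (s t) ≠ 0) :
    littlestoneDim l.table.conceptClass ≤ u + l.Y + (4 * l.Y / 5 + 1) := by
  classical
  have hY : 0 < l.Y := by omega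
  have hdiv : ∀ {x N : ℕ}, x < N * l.Y → x / l.Y < N := fun h =>
    (Nat.div_lt_iff_lt_mul hY).2 h
  have h := noMistakeTree_commit (ι := Fin l.numConcepts) (X := Fin l.numElems)
    (M := fun c => {x | l.table.mem c x = true}) (T := fun c => c.1 % 2 ^ l.Y)
    (bit := fun θ t => digitAt 2 θ t = 1)
    (W := fun c t => digitAt 2 (c.1 / 2 ^ l.Y % 2 ^ l.Y) t = 1)
    (pr := fun c => (decode l.R l.Y (c.1 / 2 ^ l.Y % 2 ^ l.Y), c.1 / 2 ^ l.Y / 2 ^ l.Y))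
    (cons := fun a t s => l.viol a.1 a.2 t s = 0) (Y := l.Y) (N := 4 * l.Y / 5 + 1)
    (fun x => ?_) (by omega) (fun m hm hmc s => ?_) (u + l.Y)
    (Finset.range l.R ×ˢ Finset.range (l.q ^ l.H)) ∅ (fun _ => 0) u l.Y rfl
    (by simpa using hu) (by simp) (by simp)
  · refine NoMistakeTree.littlestoneDim_le (h.subset ?_)
    rintro _ ⟨c, rfl⟩
    refine ⟨c, ⟨Finset.mem_product.2 ⟨Finset.mem_range.2 (Nat.mod_lt _ hR),
      Finset.mem_range.2 ?_⟩, by simp⟩, rfl⟩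
    exact Nat.div_lt_of_lt_mul (Nat.div_lt_of_lt_mul c.2)
  · have hm : ∀ c : Fin l.numConcepts, x ∈ {x | l.table.mem c x = true} ↔ l.entry c x = 1 :=
      fun c => decide_eq_true_iff
    by_cases hx : 2 ^ l.Y * l.Y ≤ x.1
    · refine .inl ⟨(x.1 - 2 ^ l.Y * l.Y) % l.Y, Nat.mod_lt _ hY, (x.1 - 2 ^ l.Y * l.Y) / l.Y,
        fun c => (hm c).trans ?_⟩
      rw [← entry_commit hY _ _ (Nat.mod_lt _ hY), Nat.div_add_mod, Nat.add_sub_of_le hx]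
    · refine .inr ⟨x.1 / l.Y, x.1 % l.Y, Nat.mod_lt _ hY, fun c => (hm c).trans ?_⟩
      rw [← entry_challenge hY _ (hdiv (not_le.1 hx)) (Nat.mod_lt _ hY), Nat.div_add_mod]
  -- The learner plays against the code word of a block `i` that no labels make consistent with the
  -- commitments.
  · obtain ⟨i, hi, hiα⟩ := hU m hm hmc s
    refine ⟨fun t => hadamard l.R i t = 1, fun c => inferInstance, fun c hc => ?_⟩
    refine card_agree_lt hRY hi fun hdec => ?_
    obtain ⟨t, ht, hne⟩ := hiα (c.1 / 2 ^ l.Y / 2 ^ l.Y)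
    exact hne (hdec ▸ hc t ht)

end Layout

/-! ### Parameters read off the input -/

namespace Layout

/-- The layout of the instance described by the numbers `μ 0, μ 1, …`. -/
def ofInput (μ : ℕ → ℕ) : Layout where
  q := μ 2
  m := μ 3
  R := Nat.sqrt (μ 0 + μ 1)
  RB := min (Nat.sqrt (μ 0 + μ 1)) (μ 1)
  H := Nat.sqrt (μ 0 + μ 1) + 3
  Y := 10 ^ 8 * μ 3 * (Nat.log 2 (μ 2 ^ 100) + 1) * (Nat.log 2 (μ 0 + μ 1) + 1)
    / Nat.sqrt (μ 0 + μ 1) + 1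
  src e := μ (4 + e * (2 + μ 2))
  tgt e := μ (4 + e * (2 + μ 2) + 1)
  proj e s := μ (4 + e * (2 + μ 2) + (2 + s))

end Layout

/-! ### Computing the incidence matrix -/

namespace RAM.Ctx

open Layout

variable {Γ Γ' : Type} {c : Ctx Γ} {c' : Ctx Γ'} {π : Γ' → Γ} {f g h i t x y α σ : Γ → ℕ}

/-- The layout described by the memory. -/
def layout (c : Ctx Γ) (γ : Γ) : Layout := ofInput (c.mem γ)

/-- The parameters of the layout are positive and polynomial in the size. -/
structure Good (c : Ctx Γ) : Prop where
  R_pos : ∀ γ, 0 < (c.layout γ).R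
  RB_pos : ∀ γ, 0 < (c.layout γ).RB
  q_pos : ∀ γ, 0 < (c.layout γ).q
  verts : c.Poly fun γ => c.mem γ 0 + c.mem γ 1
  q : c.Poly fun γ => (c.layout γ).q
  m : c.Poly fun γ => (c.layout γ).m
  qH : c.Poly fun γ => (c.layout γ).q ^ (c.layout γ).H
  pY : c.Poly fun γ => 2 ^ (c.layout γ).Y
  src_le : ∀ γ, ∀ e < (c.layout γ).m, (c.layout γ).src e ≤ c.mem γ 0 + c.mem γ 1
  tgt_le : ∀ γ, ∀ e < (c.layout γ).m, (c.layout γ).tgt e ≤ c.mem γ 0 + c.mem γ 1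

theorem Over.layout_eq (h : c'.Over c π) (γ : Γ') : c'.layout γ = c.layout (π γ) := by
  rw [layout, layout, h.mem]

theorem Over.good (h : c'.Over c π) (hc : c.Good) : c'.Good where
  R_pos γ := by rw [h.layout_eq]; exact hc.R_pos _
  RB_pos γ := by rw [h.layout_eq]; exact hc.RB_pos _
  q_pos γ := by rw [h.layout_eq]; exact hc.q_pos _
  verts := by simpa only [h.mem] using h.poly hc.verts
  q := by simpa only [h.layout_eq] using h.poly hc.q
  m := by simpa only [h.layout_eq] using h.poly hc.m
  qH := by simpa only [h.layout_eq] using h.poly hc.qH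
  pY := by simpa only [h.layout_eq] using h.poly hc.pY
  src_le γ := by rw [h.layout_eq, h.mem]; exact hc.src_le _
  tgt_le γ := by rw [h.layout_eq, h.mem]; exact hc.tgt_le _

theorem comp_mem (c : Ctx Γ) (j : ℕ) : c.Comp fun γ => c.mem γ j := .load (.const j)

theorem comp_q (c : Ctx Γ) : c.Comp fun γ => (c.layout γ).q := c.comp_mem 2

theorem comp_m (c : Ctx Γ) : c.Comp fun γ => (c.layout γ).m := c.comp_mem 3

theorem Good.Y (hc : c.Good) : c.Poly fun γ => (c.layout γ).Y :=
  hc.pY.mono fun _ => Nat.lt_two_pow_self.le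

theorem Good.R (hc : c.Good) : c.Poly fun γ => (c.layout γ).R :=
  hc.verts.mono fun _ => Nat.sqrt_le_self _

theorem Good.RB (hc : c.Good) : c.Poly fun γ => (c.layout γ).RB :=
  hc.R.mono fun _ => min_le_left _ _

theorem Good.H (hc : c.Good) : c.Poly fun γ => (c.layout γ).H := hc.R.add (.const 3)

theorem Good.comp_R (hc : c.Good) : c.Comp fun γ => (c.layout γ).R :=
  ((c.comp_mem 0).add (c.comp_mem 1)).sqrt hc.verts

theorem Good.comp_RB (hc : c.Good) : c.Comp fun γ => (c.layout γ).RB :=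
  hc.comp_R.min (c.comp_mem 1)

theorem Good.comp_H (hc : c.Good) : c.Comp fun γ => (c.layout γ).H := hc.comp_R.add (.const 3)

theorem Good.comp_Y (hc : c.Good) : c.Comp fun γ => (c.layout γ).Y := by
  have hv : c.Comp fun γ => c.mem γ 0 + c.mem γ 1 := (c.comp_mem 0).add (c.comp_mem 1)
  have h1 : c.Poly fun γ => Nat.log 2 ((c.layout γ).q ^ 100) + 1 :=
    ((hc.q.pow 100).mono fun _ => Nat.log_le_self _ _).add (.const 1)
  have h2 : c.Poly fun γ => Nat.log 2 (c.mem γ 0 + c.mem γ 1) + 1 :=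
    (hc.verts.mono fun _ => Nat.log_le_self _ _).add (.const 1)
  have c1 : c.Comp fun γ => Nat.log 2 ((c.layout γ).q ^ 100) + 1 :=
    ((c.comp_q.pow hc.q (.const 100) (.const 100)).log_two (hc.q.pow 100)).add (.const 1)
  have c2 : c.Comp fun γ => Nat.log 2 (c.mem γ 0 + c.mem γ 1) + 1 :=
    (hv.log_two hc.verts).add (.const 1)
  exact (((((Comp.const (10 ^ 8)).mul c.comp_m hc.m).mul c1 h1).mul c2 h2).div
    ((((Poly.const (10 ^ 8)).mul hc.m).mul h1).mul h2) hc.comp_R hc.R_pos).add (.const 1)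

theorem Good.comp_pY (hc : c.Good) : c.Comp fun γ => 2 ^ (c.layout γ).Y :=
  (Comp.const 2).pow (.const 2) hc.comp_Y hc.Y

theorem Good.comp_qH (hc : c.Good) : c.Comp fun γ => (c.layout γ).q ^ (c.layout γ).H :=
  c.comp_q.pow hc.q hc.comp_H hc.H

theorem Good.comp_edge (hc : c.Good) (hf : c.Comp f) :
    c.Comp fun γ => 4 + f γ * (2 + c.mem γ 2) :=
  (Comp.const 4).add (hf.mul ((Comp.const 2).add c.comp_q) ((Poly.const 2).add hc.q))

theorem Good.comp_src (hc : c.Good) (hf : c.Comp f) : c.Comp fun γ => (c.layout γ).src (f γ) :=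
  (hc.comp_edge hf).load

theorem Good.comp_tgt (hc : c.Good) (hf : c.Comp f) : c.Comp fun γ => (c.layout γ).tgt (f γ) :=
  ((hc.comp_edge hf).add (.const 1)).load

theorem Good.comp_proj (hc : c.Good) (hf : c.Comp f) (hg : c.Comp g) :
    c.Comp fun γ => (c.layout γ).proj (f γ) (g γ) :=
  ((hc.comp_edge hf).add ((Comp.const 2).add hg)).load

theorem Comp.digitAt (hf : c.Comp f) (hfp : c.Poly f) (h0 : ∀ γ, 0 < f γ) (hg : c.Comp g)
    (hgp : c.Poly g) (hh : c.Comp h) (hhp : c.Poly h) :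
    c.Comp fun γ => digitAt (f γ) (g γ) (h γ) :=
  (hg.div hgp (hf.pow hfp hh hhp) fun γ => pow_pos (h0 γ) _).mod
    (hgp.mono fun _ => Nat.div_le_self _ _) hf h0

theorem Comp.bit (hg : c.Comp g) (hgp : c.Poly g) (hh : c.Comp h) (hhp : c.Poly h) :
    c.Comp fun γ => _root_.digitAt 2 (g γ) (h γ) :=
  .digitAt (.const 2) (.const 2) (fun _ => two_pos) hg hgp hh hhp

theorem Good.comp_hadamard (hc : c.Good) (hi : c.Comp i) (hip : c.Poly i) (ht : c.Comp t)
    (htp : c.Poly t) : c.Comp fun γ => hadamard (c.layout γ).R (i γ) (t γ) := by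
  have hp : c.Poly fun γ => ∑ p ∈ Finset.range (c.layout γ).R,
      _root_.digitAt 2 (i γ) p * _root_.digitAt 2 (t γ) p := by
    refine hc.R.mono fun γ => (Finset.sum_le_card_nsmul _ _ 1 fun p _ => ?_).trans (by simp)
    exact Nat.mul_le_mul (Nat.lt_succ_iff.1 (Nat.mod_lt _ two_pos))
      (Nat.lt_succ_iff.1 (Nat.mod_lt _ two_pos))
  refine Comp.mod (Comp.sum (g := fun γ p => _root_.digitAt 2 (i γ) p * _root_.digitAt 2 (t γ) p)
    hc.comp_R hc.R fun c' h hidx => ?_) hp (.const 2) fun _ => two_pos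
  have hidxp := h.poly_idx hc.R
  exact (Comp.bit (h.comp hi) (h.poly hip) hidx hidxp).mul
    (Comp.bit (h.comp ht) (h.poly htp) hidx hidxp)
    ((Poly.const 1).mono fun γ => Nat.lt_succ_iff.1 (Nat.mod_lt _ two_pos))

theorem Good.comp_codeDist (hc : c.Good) (hx : c.Comp x) (hxp : c.Poly x) (hi : c.Comp i)
    (hip : c.Poly i) : c.Comp fun γ => codeDist (c.layout γ).R (c.layout γ).Y (x γ) (i γ) := by
  refine Comp.sum (g := fun γ t =>
    if _root_.digitAt 2 (x γ) t = hadamard (c.layout γ).R (i γ) t then 0 else 1)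
    hc.comp_Y hc.Y fun c' h hidx => ?_
  have hidxp := h.poly_idx hc.Y
  refine Comp.ite_prop (.eq (.bit (h.comp hx) (h.poly hxp) hidx hidxp) ?_) (.const 0) (.const 1)
  simpa only [h.layout_eq] using
    (h.good hc).comp_hadamard (h.comp hi) (h.poly hip) hidx hidxp

theorem Good.comp_decode (hc : c.Good) (hx : c.Comp x) (hxp : c.Poly x) :
    c.Comp fun γ => decode (c.layout γ).R (c.layout γ).Y (x γ) := by
  have hp : c.Poly fun γ => ∑ i ∈ Finset.range (c.layout γ).R,
      if 5 * codeDist (c.layout γ).R (c.layout γ).Y (x γ) i + 1 ≤ (c.layout γ).Y then i else 0 := by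
    refine (hc.R.mul hc.R).mono fun γ =>
      (Finset.sum_le_card_nsmul _ _ (c.layout γ).R fun i hi => ?_).trans (by simp)
    have := Finset.mem_range.1 hi
    split_ifs <;> omega
  refine Comp.mod (Comp.sum (g := fun γ i =>
    if 5 * codeDist (c.layout γ).R (c.layout γ).Y (x γ) i + 1 ≤ (c.layout γ).Y then i else 0)
    hc.comp_R hc.R fun c' h hidx => ?_) hp hc.comp_R hc.R_pos
  have hd := (h.good hc).comp_codeDist (h.comp hx) (h.poly hxp) hidx (h.poly_idx hc.R)
  have hdp : c'.Poly fun γ => codeDist (c'.layout γ).R (c'.layout γ).Y (x γ.base) γ.idx := by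
    refine (h.good hc).Y.mono fun γ => ?_
    rw [codeDist_eq_card]
    exact (Finset.card_filter_le _ _).trans (Finset.card_range _).le
  refine Comp.ite_prop (Comp.le ?_ (h.comp hc.comp_Y)) hidx (.const 0)
  simpa only [h.layout_eq] using ((Comp.const 5).mul hd hdp).add (.const 1)

/-- Division and remainder cost as much as the dividend, so the endpoints of edges need a polynomial
bound. The values of projections are only compared and need none. -/
theorem Good.comp_viol (hc : c.Good) (hi : c.Comp i) (hα : c.Comp α) (hαp : c.Poly α)
    (ht : c.Comp t) (htp : c.Poly t) (hσ : c.Comp σ) (hσp : c.Poly σ) :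
    c.Comp fun γ => (c.layout γ).viol (i γ) (α γ) (t γ) (σ γ) := by
  refine Comp.sum (g := fun γ e => if (c.layout γ).src e % (c.layout γ).R = i γ then
    if (c.layout γ).tgt e % (c.layout γ).RB = t γ % (c.layout γ).RB then
      if (c.layout γ).proj e
          (_root_.digitAt (c.layout γ).q (α γ) ((c.layout γ).src e / (c.layout γ).R))
        = _root_.digitAt (c.layout γ).q (σ γ) ((c.layout γ).tgt e / (c.layout γ).RB) then 0 else 1
    else 0
  else 0) c.comp_m hc.m fun c' h hidx => ?_
  have hg := h.good hc
  have hs : c'.Comp fun x => (c.layout x.base).src x.idx := by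
    simpa only [h.layout_eq] using hg.comp_src hidx
  have hsp : c'.Poly fun x => (c.layout x.base).src x.idx :=
    (h.poly hc.verts).mono fun x => hc.src_le _ _ x.lt
  have ht' : c'.Comp fun x => (c.layout x.base).tgt x.idx := by
    simpa only [h.layout_eq] using hg.comp_tgt hidx
  have htp' : c'.Poly fun x => (c.layout x.base).tgt x.idx :=
    (h.poly hc.verts).mono fun x => hc.tgt_le _ _ x.lt
  have hR := h.comp hc.comp_R
  have hRB := h.comp hc.comp_RB
  have hq := h.comp c.comp_q
  have hA := Comp.digitAt hq (h.poly hc.q) (fun x => hc.q_pos _) (h.comp hα) (h.poly hαp)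
    (hs.div hsp hR fun x => hc.R_pos _) (hsp.mono fun x => Nat.div_le_self _ _)
  have hB := Comp.digitAt hq (h.poly hc.q) (fun x => hc.q_pos _) (h.comp hσ) (h.poly hσp)
    (ht'.div htp' hRB fun x => hc.RB_pos _) (htp'.mono fun x => Nat.div_le_self _ _)
  have hP : c'.Comp fun x => (c.layout x.base).proj x.idx
      (_root_.digitAt (c.layout x.base).q (α x.base)
        ((c.layout x.base).src x.idx / (c.layout x.base).R)) := by
    simpa only [h.layout_eq] using hg.comp_proj hidx hA
  exact .ite_prop (.eq (hs.mod hsp hR fun x => hc.R_pos _) (h.comp hi))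
    (.ite_prop (.eq (ht'.mod htp' hRB fun x => hc.RB_pos _)
      ((h.comp ht).mod (h.poly htp) hRB fun x => hc.RB_pos _))
      (.ite_prop (.eq hP hB) (.const 0) (.const 1)) (.const 0)) (.const 0)

theorem Good.comp_numElems (hc : c.Good) : c.Comp fun γ => (c.layout γ).numElems :=
  (hc.comp_pY.mul hc.comp_Y hc.Y).add (hc.comp_qH.mul hc.comp_Y hc.Y)

theorem Good.numElems (hc : c.Good) : c.Poly fun γ => (c.layout γ).numElems :=
  (hc.pY.mul hc.Y).add (hc.qH.mul hc.Y)

theorem Good.comp_numConcepts (hc : c.Good) : c.Comp fun γ => (c.layout γ).numConcepts :=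
  hc.comp_pY.mul (hc.comp_pY.mul hc.comp_qH hc.qH) (hc.pY.mul hc.qH)

theorem Good.numConcepts (hc : c.Good) : c.Poly fun γ => (c.layout γ).numConcepts :=
  hc.pY.mul (hc.pY.mul hc.qH)

theorem Good.comp_entry (hc : c.Good) (hx : c.Comp x) (hxp : c.Poly x) (hy : c.Comp y)
    (hyp : c.Poly y) : c.Comp fun γ => (c.layout γ).entry (x γ) (y γ) := by
  have hP0 : ∀ γ, 0 < 2 ^ (c.layout γ).Y := fun _ => by positivity
  have hY0 : ∀ γ, 0 < (c.layout γ).Y := fun _ => Nat.succ_pos _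
  have hn := hc.comp_pY.mul hc.comp_Y hc.Y
  have hT := hx.mod hxp hc.comp_pY hP0
  have hTp : c.Poly fun γ => x γ % 2 ^ (c.layout γ).Y := hxp.mono fun _ => Nat.mod_le _ _
  have hd := hx.div hxp hc.comp_pY hP0
  have hdp : c.Poly fun γ => x γ / 2 ^ (c.layout γ).Y := hxp.mono fun _ => Nat.div_le_self _ _
  have hW := hd.mod hdp hc.comp_pY hP0
  have hWp : c.Poly fun γ => x γ / 2 ^ (c.layout γ).Y % 2 ^ (c.layout γ).Y :=
    hdp.mono fun _ => Nat.mod_le _ _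
  have hα := hd.div hdp hc.comp_pY hP0
  have hαp : c.Poly fun γ => x γ / 2 ^ (c.layout γ).Y / 2 ^ (c.layout γ).Y :=
    hdp.mono fun _ => Nat.div_le_self _ _
  have hz := hy.sub hn
  have hzp : c.Poly fun γ => y γ - 2 ^ (c.layout γ).Y * (c.layout γ).Y :=
    hyp.mono fun _ => Nat.sub_le _ _
  have ht := hz.mod hzp hc.comp_Y hY0
  have htp : c.Poly fun γ => (y γ - 2 ^ (c.layout γ).Y * (c.layout γ).Y) % (c.layout γ).Y :=
    hzp.mono fun _ => Nat.mod_le _ _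
  have hσ := hz.div hzp hc.comp_Y hY0
  have hσp : c.Poly fun γ => (y γ - 2 ^ (c.layout γ).Y * (c.layout γ).Y) / (c.layout γ).Y :=
    hzp.mono fun _ => Nat.div_le_self _ _
  exact .ite_prop (hn.le hy)
    (.ite_prop (.eq (.bit hT hTp ht htp) (.const 1))
      (.ite_prop (.eq (hc.comp_viol (hc.comp_decode hW hWp) hα hαp ht htp hσ hσp) (.const 0))
        (.const 1) (.const 0)) (.const 0))
    (.ite_prop (.eq (hy.div hyp hc.comp_Y hY0) hT)
      (.bit hW hWp (hy.mod hyp hc.comp_Y hY0) (hyp.mono fun _ => Nat.mod_le _ _)) (.const 0))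

theorem encode_table (l : Layout) : l.table.encode = [l.numElems] ++ ([l.numConcepts] ++
    (List.range l.numConcepts).flatMap fun i => (List.range l.numElems).flatMap fun j =>
      [if l.entry i j = 1 then 1 else 0]) := by
  have h1 : ∀ {β : Type} (n : ℕ) (F : ℕ → List β),
      (List.finRange n).flatMap (fun i : Fin n => F i.1) = (List.range n).flatMap F := by
    intro β n F
    rw [← List.map_coe_finRange_eq_range, List.flatMap_map]
  simp only [← h1, ConceptTable.encode, List.cons_append, List.nil_append]
  refine congrArg (fun F => l.numElems :: l.numConcepts :: List.flatMap F _) (funext fun i => ?_)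
  rw [← List.map_eq_flatMap]
  refine List.map_congr_left fun j _ => ?_
  by_cases h : l.entry i j = 1 <;> simp [table, h]

attribute [irreducible] layout

theorem Good.emits_table (hc : c.Good) : c.Emits fun γ => (c.layout γ).table.encode := by
  simp only [encode_table]
  refine (Emits.single hc.comp_numElems).append ((Emits.single hc.comp_numConcepts).append ?_)
  refine Emits.flatMap (l := fun γ i => (List.range (c.layout γ).numElems).flatMap fun j =>
      [if (c.layout γ).entry i j = 1 then 1 else 0]) hc.comp_numConcepts hc.numConcepts
    fun c₁ h₁ i₁ => ?_
  refine Emits.flatMap (l := fun γ j => [if (c.layout γ.base).entry γ.idx j = 1 then 1 else 0])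
    (h₁.comp hc.comp_numElems) (h₁.poly hc.numElems) fun c₂ h₂ i₂ => ?_
  refine .single (Comp.ite_prop (Comp.eq ?_ (.const 1)) (.const 1) (.const 0))
  simpa only [h₂.layout_eq, h₁.layout_eq] using
    (h₂.good (h₁.good hc)).comp_entry (h₂.comp i₁) (h₂.poly (h₁.poly_idx hc.numConcepts)) i₂
      (h₂.poly_idx (h₁.poly hc.numElems))

end RAM.Ctx

/-! ### Label Cover instances as inputs -/

theorem List.getD_flatMap {α β : Type*} {K j : ℕ} (hj : j < K) (g : α → List β)
    (hg : ∀ x, (g x).length = K) (d : β) (xs : List α) (i : ℕ) (hi : i < xs.length) :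
    (xs.flatMap g).getD (i * K + j) d = (g xs[i]).getD j d := by
  induction xs generalizing i with
  | nil => simp at hi
  | cons x xs ih =>
    rw [List.flatMap_cons]
    obtain _ | i := i
    · rw [List.getD_append _ _ _ _ (by rw [hg]; omega)]
      simp
    · rw [List.getD_append_right _ _ _ _ (by rw [hg, Nat.succ_mul]; omega), hg,
        show (i + 1) * K + j - K = i * K + j by rw [Nat.succ_mul]; omega,
        ih i (by simpa using hi)]
      simp

namespace LabelCover

variable {a b m q : ℕ} (L : LabelCover (Fin a) (Fin b) (Fin m) (Fin q))

/-- The memory that holds the description of the instance. -/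
def input (i : ℕ) : ℕ := L.encode.getD i 0

/-- The layout of the instance. -/
def layout : Layout := .ofInput L.input

theorem input_edge (e : Fin m) {j : ℕ} (hj : j < 2 + q) : L.input (4 + (e.1 * (2 + q) + j))
    = ([(L.src e : ℕ), (L.tgt e : ℕ)] ++ (List.finRange q).map fun s => (L.proj e s : ℕ)).getD
      j 0 := by
  rw [input, encode, List.getD_append_right _ _ _ _ (by simp)]
  have := List.getD_flatMap hj (fun e =>
    [(L.src e : ℕ), (L.tgt e : ℕ)] ++ (List.finRange q).map fun s => (L.proj e s : ℕ))
    (fun e => by simp; omega) 0 (List.finRange m) e.1 (by simp)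
  simpa using this

theorem layout_q : L.layout.q = q := rfl
theorem layout_R : L.layout.R = Nat.sqrt (a + b) := rfl
theorem layout_RB : L.layout.RB = min (Nat.sqrt (a + b)) b := rfl
theorem layout_H : L.layout.H = Nat.sqrt (a + b) + 3 := rfl
theorem layout_Y : L.layout.Y = 10 ^ 8 * m * (Nat.log 2 (q ^ 100) + 1) * (Nat.log 2 (a + b) + 1)
    / Nat.sqrt (a + b) + 1 := rfl

theorem layout_src (e : Fin m) : L.layout.src e = L.src e :=
  (L.input_edge e (j := 0) (by omega)).trans (by simp)

theorem layout_tgt (e : Fin m) : L.layout.tgt e = L.tgt e :=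
  (L.input_edge e (j := 1) (by omega)).trans (by simp)

theorem layout_proj (e : Fin m) (s : Fin q) : L.layout.proj e s = L.proj e s := by
  have := L.input_edge e (j := 2 + s) (by omega)
  rw [← add_assoc] at this
  refine this.trans ?_
  rw [List.getD_append_right _ _ _ _ (by simp)]
  simp

/-- From `n ≤ R² + 2R` the position of a vertex within its block is less than `R + 3 = H`. -/
theorem src_div_lt (hn : 0 < a + b) {e : ℕ} (he : e < L.layout.m) :
    L.layout.src e / L.layout.R < L.layout.H := by
  have h1 := L.layout_src ⟨e, he⟩
  have h2 := (L.src ⟨e, he⟩).2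
  have h3 := Nat.sqrt_le_add (a + b)
  have h4 := Nat.sqrt_pos.2 hn
  refine Nat.div_lt_of_lt_mul ?_
  rw [layout_R, layout_H, Nat.mul_add]
  simp only at h1
  omega

theorem tgt_div_lt (hn : 0 < a + b) {e : ℕ} (he : e < L.layout.m) :
    L.layout.tgt e / L.layout.RB < L.layout.H := by
  have h1 := L.layout_tgt ⟨e, he⟩
  have h2 := (L.tgt ⟨e, he⟩).2
  have h3 := Nat.sqrt_le_add (a + b)
  have h4 := Nat.sqrt_pos.2 hn
  refine Nat.div_lt_of_lt_mul ?_
  rw [layout_RB, layout_H]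
  simp only at h1
  rcases min_choice (Nat.sqrt (a + b)) b with h | h
  · rw [h, Nat.mul_add]
    omega
  · rw [h, Nat.mul_add]
    omega

theorem Satisfiable.le_littlestoneDim {L : LabelCover (Fin a) (Fin b) (Fin m) (Fin q)}
    (h : L.Satisfiable) (hn : 0 < a + b) (hq : 0 < q) :
    2 * L.layout.Y ≤ littlestoneDim L.layout.table.conceptClass := by
  obtain ⟨φ, hφ⟩ := h
  refine Layout.le_littlestoneDim (Nat.succ_pos _)
    (fun u => if hu : u < a then φ (.inl ⟨u, hu⟩) else 0)
    (fun v => if hv : v < b then φ (.inr ⟨v, hv⟩) else 0) (fun u => ?_) (fun v => ?_)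
    (fun _ => L.src_div_lt hn) (fun _ => L.tgt_div_lt hn) fun e he => ?_
  · split_ifs
    exacts [Fin.is_lt _, hq]
  · split_ifs
    exacts [Fin.is_lt _, hq]
  · have hs := L.layout_src ⟨e, he⟩
    have ht := L.layout_tgt ⟨e, he⟩
    simp only at hs ht
    rw [hs, ht, dif_pos (Fin.is_lt _), dif_pos (Fin.is_lt _)]
    exact (L.layout_proj ⟨e, he⟩ _).trans (congrArg Fin.val (hφ ⟨e, he⟩))

/-! ### Soundness of the commitments -/

/-- Many rounds have many residues, and many residues contain many vertices. -/
theorem _root_.Finset.le_eight_mul_card_mod {b Y K : ℕ} (hK : 0 < K) (hKb : K ≤ b) (hKY : K ≤ Y)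
    (s : Finset ℕ) (hs : s ⊆ Finset.range Y) (hsY : Y ≤ 2 * s.card) :
    b ≤ 8 * ((Finset.range b).filter fun v => v % K ∈ s.image (· % K)).card := by
  set J := s.image (· % K) with hJ
  have hJK : ∀ j ∈ J, j < K := by
    intro j hj
    obtain ⟨t, -, rfl⟩ := Finset.mem_image.1 hj
    exact Nat.mod_lt _ hK
  -- A residue occurs at most `Y / K + 1 ≤ 2 Y / K` times below `Y`, so there are at least `K / 4`
  -- residues in `J`; each occurs at least `b / (2 K)` times below `b`.
  have h1 : s.card ≤ J.card * (Y / K + 1) := by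
    rw [← Finset.card_range (Y / K + 1), ← Finset.card_product]
    refine Finset.card_le_card_of_injOn (fun t => (t % K, t / K)) (fun t ht => ?_) ?_
    · refine Finset.mem_coe.2 (Finset.mem_product.2 ⟨Finset.mem_image_of_mem _ ht,
        Finset.mem_range.2 (Nat.lt_succ_of_le (Nat.div_le_div_right ?_))⟩)
      exact (Finset.mem_range.1 (hs ht)).le
    · intro t _ t' _ h
      simp only [Prod.mk.injEq] at h
      rw [← Nat.div_add_mod t K, ← Nat.div_add_mod t' K, h.1, h.2]
  have h2 : J.card * (b / K)
      ≤ ((Finset.range b).filter fun v => v % K ∈ J).card := by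
    rw [← Finset.card_range (b / K), ← Finset.card_product]
    refine Finset.card_le_card_of_injOn (fun x => K * x.2 + x.1) (fun x hx => ?_) ?_
    · obtain ⟨hx1, hx2⟩ := Finset.mem_product.1 (Finset.mem_coe.1 hx)
      have h3 := hJK _ hx1
      refine Finset.mem_coe.2 (Finset.mem_filter.2 ⟨Finset.mem_range.2 ?_, ?_⟩)
      · have h4 := Nat.mul_le_mul_left K (Nat.succ_le_of_lt (Finset.mem_range.1 hx2))
        have h5 := Nat.mul_div_le b K
        rw [Nat.mul_succ] at h4
        dsimp only
        omega
      · rwa [Nat.mul_add_mod, Nat.mod_eq_of_lt h3]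
    · intro x hx y hy h
      have hx1 := hJK _ (Finset.mem_product.1 (Finset.mem_coe.1 hx)).1
      have hy1 := hJK _ (Finset.mem_product.1 (Finset.mem_coe.1 hy)).1
      have e1 := congrArg (· % K) h
      have e2 := congrArg (· / K) h
      simp only [Nat.mul_add_mod, Nat.mod_eq_of_lt hx1, Nat.mod_eq_of_lt hy1,
        Nat.mul_add_div hK, Nat.div_eq_of_lt hx1, Nat.div_eq_of_lt hy1, add_zero] at e1 e2
      exact Prod.ext e1 e2
  have h3 : K * (Y / K + 1) ≤ 2 * Y := by
    have := Nat.mul_div_le Y K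
    rw [Nat.mul_succ]
    omega
  have h4 : K ≤ 4 * J.card := by
    by_contra! hlt
    have h5 : Y * K ≤ J.card * (4 * Y) := by
      calc Y * K ≤ 2 * (J.card * (Y / K + 1)) * K := by gcongr; omega
        _ = 2 * J.card * (K * (Y / K + 1)) := by ring
        _ ≤ 2 * J.card * (2 * Y) := by gcongr
        _ = _ := by ring
    have h6 : Y * (4 * J.card) < Y * K := Nat.mul_lt_mul_of_pos_left hlt (by omega)
    have h7 : J.card * (4 * Y) = Y * (4 * J.card) := by ring
    omega
  have h5 : b ≤ 2 * (K * (b / K)) := by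
    have h6 := Nat.div_add_mod b K
    have h7 := Nat.mod_lt b hK
    have h8 : K * 1 ≤ K * (b / K) := Nat.mul_le_mul_left K (Nat.div_pos hKb hK)
    omega
  have h6 : K * (b / K) ≤ 4 * (J.card * (b / K)) := by
    rw [← mul_assoc]
    exact Nat.mul_le_mul_right _ h4
  omega

/-- If every block of `A` had labels consistent with the commitments, these labels and the committed
ones would together satisfy all edges into the committed blocks of `B`. Those blocks contain at
least `1/8` of `B`, hence by regularity receive `1/8` of the edges, against the small value. -/
theorem BiRegular.exists_viol {L : LabelCover (Fin a) (Fin b) (Fin m) (Fin q)} (h : L.BiRegular)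
    (hm : 0 < m) (hq : 0 < q) (hv : L.value ≤ 0.001) (hR : 0 < L.layout.R)
    (hRY : L.layout.R ≤ L.layout.Y) (s : Finset ℕ)
    (hs : s ⊆ Finset.range L.layout.Y) (hsY : L.layout.Y ≤ 2 * s.card) (σ : ℕ → ℕ) :
    ∃ i < L.layout.R, ∀ α, ∃ t ∈ s, L.layout.viol i α t (σ t) ≠ 0 := by
  classical
  by_contra! hc
  have hb : 0 < b := (Nat.zero_le _).trans_lt (L.tgt ⟨0, hm⟩).2
  have hRB : 0 < L.layout.RB := lt_min hR hb
  choose! α hα using hc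
  -- Different rounds may commit to different labels of the same block; one round `τ j` is fixed for
  -- each residue `j`. Blocks of `B` without a commitment get irrelevant labels.
  choose! τ hτ hτm using fun (j : ℕ) (hj : j ∈ s.image (· % L.layout.RB)) => Finset.mem_image.1 hj
  let φ : Fin a ⊕ Fin b → Fin q := Sum.elim
    (fun u => ⟨digitAt q (α (u % L.layout.R)) (u / L.layout.R), Nat.mod_lt _ hq⟩)
    (fun v => ⟨digitAt q (σ (τ (v % L.layout.RB))) (v / L.layout.RB), Nat.mod_lt _ hq⟩)
  have hsat : ∀ e, (L.tgt e : ℕ) % L.layout.RB ∈ s.image (· % L.layout.RB) → L.Sat φ e := by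
    intro e he
    have h1 := Layout.viol_eq_zero.1 (hα (L.src e % L.layout.R) (Nat.mod_lt _ hR) _ (hτ _ he)) e e.2
    rw [layout_src, layout_tgt, layout_q, hτm _ he] at h1
    have h2 := h1 rfl rfl
    refine Fin.ext (Eq.trans ?_ h2)
    exact (L.layout_proj e ⟨_, _⟩).symm
  obtain ⟨-, d, hd⟩ := h
  have hd' : ∀ y, (Finset.univ.filter fun e => L.tgt e = y).card = d := by
    intro y
    rw [← hd y, Nat.card_eq_fintype_card, Fintype.card_subtype]
  have hcard : ∀ S : Finset (Fin b), (Finset.univ.filter fun e => L.tgt e ∈ S).card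
      = S.card * d := by
    intro S
    rw [Finset.card_eq_sum_card_fiberwise (t := S) (f := L.tgt)
      (fun e he => Finset.mem_coe.2 (Finset.mem_filter.1 (Finset.mem_coe.1 he)).2), ← smul_eq_mul, ← Finset.sum_const]
    refine Finset.sum_congr rfl fun y hy => ?_
    rw [← hd' y, Finset.filter_filter]
    refine congrArg _ (Finset.filter_congr fun e _ => ?_)
    exact ⟨fun h => h.2, fun h => ⟨h ▸ hy, h⟩⟩
  have hmd : m = b * d := by simpa using hcard Finset.univ
  set S : Finset (Fin b) :=
    Finset.univ.filter fun v => (v : ℕ) % L.layout.RB ∈ s.image (· % L.layout.RB) with hS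
  have hSb : b ≤ 8 * S.card := by
    have := Finset.le_eight_mul_card_mod hRB (min_le_right _ _) ((min_le_left _ _).trans hRY)
      s hs hsY
    refine this.trans (Nat.mul_le_mul_left 8 ?_)
    refine Finset.card_le_card_of_surjOn (fun v : Fin b => (v : ℕ)) fun v hv => ?_
    obtain ⟨h1, h2⟩ := Finset.mem_filter.1 (Finset.mem_coe.1 hv)
    exact ⟨⟨v, Finset.mem_range.1 h1⟩, by simpa [hS] using h2, rfl⟩
  have hle : (Finset.univ.filter fun e => L.tgt e ∈ S).card ≤ Nat.card {e // L.Sat φ e} := by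
    rw [Nat.card_eq_fintype_card, Fintype.card_subtype]
    refine Finset.card_le_card fun e he => ?_
    simp only [Finset.mem_filter, Finset.mem_univ, true_and, hS] at he ⊢
    exact hsat e he
  rw [hcard] at hle
  have hm8 : m ≤ 8 * Nat.card {e // L.Sat φ e} := by
    calc m = b * d := hmd
      _ ≤ 8 * S.card * d := Nat.mul_le_mul_right _ hSb
      _ = 8 * (S.card * d) := mul_assoc _ _ _
      _ ≤ _ := Nat.mul_le_mul_left _ hle
  have h1 : L.assignmentValue φ ≤ L.value :=
    le_ciSup (Set.finite_range L.assignmentValue).bddAbove φ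
  have h2 : (1 : ℝ) / 8 ≤ L.assignmentValue φ := by
    rw [assignmentValue, Nat.card_fin, le_div_iff₀ (by exact_mod_cast hm)]
    have : (m : ℝ) ≤ 8 * (Nat.card {e // L.Sat φ e} : ℝ) := by exact_mod_cast hm8
    linarith
  norm_num at hv
  linarith

end LabelCover

/-! ### Estimates for the parameters -/

theorem Nat.logb_two_le_log_add_one {x : ℕ} (hx : 0 < x) :
    Real.logb 2 x ≤ (Nat.log 2 x + 1 : ℕ) := by
  have h := Nat.lt_pow_succ_log_self one_lt_two x
  rw [Real.logb_le_iff_le_rpow one_lt_two (by exact_mod_cast hx), Real.rpow_natCast]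
  exact_mod_cast h.le

theorem Nat.log_le_logb_two {x : ℕ} (hx : 0 < x) : (Nat.log 2 x : ℝ) ≤ Real.logb 2 x := by
  rw [Real.le_logb_iff_rpow_le one_lt_two (by exact_mod_cast hx), Real.rpow_natCast]
  exact_mod_cast Nat.pow_log_le_self 2 hx.ne'

theorem Nat.le_two_pow_of_logb_le {x y : ℕ} (hx : 0 < x) (h : Real.logb 2 x ≤ y) : x ≤ 2 ^ y := by
  rw [Real.logb_le_iff_le_rpow one_lt_two (by exact_mod_cast hx), Real.rpow_natCast] at h
  exact_mod_cast h

theorem Nat.mul_self_le_two_pow {x : ℕ} (hx : 4 ≤ x) : x * x ≤ 2 ^ x := by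
  induction x, hx using Nat.le_induction with
  | base => norm_num
  | succ x hx ih =>
    rw [pow_succ]
    nlinarith

/-- Here `G` is `rk / 10 ^ 10`. The largeness of `N` makes all rounding errors in `Y` small: about
1% from `A`, half a percent from `B`, and a tiny one from replacing `√N` by its integer part. -/
theorem rounds_estimates {N m q R Y : ℕ} {G : ℝ} (hN : 2 ^ 200 ≤ N) (hm : N ≤ 2 * m) (hq : 2 ≤ q)
    (hR : R = Nat.sqrt N)
    (hY : Y = 10 ^ 8 * m * (Nat.log 2 (q ^ 100) + 1) * (Nat.log 2 N + 1) / R + 1)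
    (hG : G = m * Real.logb 2 q * Real.logb 2 N / Real.sqrt N) :
    1 ≤ G ∧ 10 ^ 10 * G ≤ Y ∧ (Y : ℝ) ≤ 1.05 * 10 ^ 10 * G ∧ 20 * R ≤ Y ∧ N ≤ 2 ^ Y ∧ q ≤ 2 ^ Y ∧
      m ≤ 2 ^ Y ∧ q ^ (R + 3) ≤ 2 ^ Y ∧ ∃ u : ℕ, R * q ^ (R + 3) < 2 ^ u ∧ (u : ℝ) ≤ G := by
  have hN0 : 0 < N := lt_of_lt_of_le (by positivity) hN
  have hNR : (2 : ℝ) ^ 200 ≤ N := by exact_mod_cast hN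
  set S := Real.sqrt N with hS
  set ℓ := Real.logb 2 N with hℓ
  set lam := Real.logb 2 q with hlam
  have hSS : S * S = N := Real.mul_self_sqrt (Nat.cast_nonneg N)
  have hS1 : (2 : ℝ) ^ 100 ≤ S := Real.le_sqrt_of_sq_le (by rw [← pow_mul]; exact hNR)
  have hS2 : (10 : ℝ) ^ 4 ≤ S := le_trans (by norm_num) hS1
  have hℓ1 : 200 ≤ ℓ := by
    rw [hℓ, Real.le_logb_iff_rpow_le one_lt_two (by exact_mod_cast hN0)]
    exact_mod_cast hN
  have hlam1 : 1 ≤ lam := by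
    rw [hlam, Real.le_logb_iff_rpow_le one_lt_two (by exact_mod_cast (by omega : 0 < q)),
      Real.rpow_one]
    exact_mod_cast hq
  have hm' : (N : ℝ) ≤ 2 * m := by exact_mod_cast hm
  have hS0 : 0 < S := by linarith
  have hm0 : (0 : ℝ) < m := by
    have : (0 : ℝ) < N := by exact_mod_cast hN0
    linarith
  have hGS : G * S = m * lam * ℓ := by
    rw [hG]
    field_simp
  have hmS : S ≤ 2 * (m / S) := by
    rw [mul_div_assoc', le_div_iff₀ hS0]
    linarith
  have hG1 : S * lam * ℓ ≤ 2 * G := by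
    have : 2 * G = 2 * (m / S) * (lam * ℓ) := by
      rw [hG]
      ring
    rw [this, mul_assoc]
    exact mul_le_mul_of_nonneg_right hmS (by positivity)
  -- The factor `log₂ N ≥ 200` in `G` is what makes the labels of a block, about `√N log₂ q` bits,
  -- cheaper than `G`.
  have hG2 : 100 * (S * lam) ≤ G := by
    have : S * lam * 200 ≤ S * lam * ℓ := mul_le_mul_of_nonneg_left hℓ1 (by positivity)
    linarith
  have hSl : S ≤ S * lam := le_mul_of_one_le_right hS0.le hlam1
  have hlS : lam ≤ S * lam := le_mul_of_one_le_left (by linarith) (by linarith)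
  have hG3 : (10 : ℝ) ^ 6 ≤ G := by linarith
  have hℓG : ℓ ≤ 2 * G := by
    refine le_trans ?_ hG1
    have : (1 : ℝ) ≤ S * lam := by linarith
    exact le_mul_of_one_le_left (by linarith) this
  have hRS : (R : ℝ) ≤ S := by
    rw [hR]
    exact Real.nat_sqrt_le_real_sqrt
  have hSR : S ≤ R + 1 := by
    rw [hR]
    exact Real.real_sqrt_le_nat_sqrt_succ
  have hR0 : (0 : ℝ) < R := by linarith
  have hR0' : 0 < R := by exact_mod_cast hR0
  obtain ⟨A, hA⟩ : ∃ A, A = Nat.log 2 (q ^ 100) + 1 := ⟨_, rfl⟩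
  obtain ⟨B, hB⟩ : ∃ B, B = Nat.log 2 N + 1 := ⟨_, rfl⟩
  have hql : Real.logb 2 ((q ^ 100 : ℕ) : ℝ) = 100 * lam := by
    rw [Nat.cast_pow, Real.logb_pow, hlam, Nat.cast_ofNat]
  -- Taking the logarithm of the 100th power keeps the relative rounding error near 1% even for `q =
  -- 2`; the factor `100` completes `10 ^ 8` to `10 ^ 10`.
  have hA1 : 100 * lam ≤ A := by
    rw [← hql, hA]
    exact Nat.logb_two_le_log_add_one (by positivity)
  have hA2 : (A : ℝ) ≤ 101 * lam := by
    have := Nat.log_le_logb_two (x := q ^ 100) (by positivity)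
    rw [hql] at this
    rw [hA]
    push_cast
    linarith
  have hB1 : ℓ ≤ B := hB ▸ Nat.logb_two_le_log_add_one hN0
  have hB2 : (B : ℝ) ≤ 1.005 * ℓ := by
    have := Nat.log_le_logb_two hN0
    rw [hB]
    push_cast
    linarith
  rw [← hA, ← hB] at hY
  obtain ⟨X, hX⟩ : ∃ X, X = 10 ^ 8 * m * A * B := ⟨_, rfl⟩
  rw [← hX] at hY
  have hXR : (X : ℝ) = 10 ^ 8 * m * A * B := by
    rw [hX]
    push_cast
    ring
  have hYl : (X : ℝ) ≤ Y * R := by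
    have h1 := Nat.div_add_mod X R
    have h2 := Nat.mod_lt X hR0'
    have : X ≤ Y * R := by
      rw [hY, Nat.add_mul, mul_comm]
      omega
    exact_mod_cast this
  have hYu : (Y : ℝ) ≤ X / R + 1 := by
    rw [hY]
    push_cast
    linarith [@Nat.cast_div_le ℝ _ _ _ X R]
  have hlo : 10 ^ 10 * G ≤ Y := by
    have h1 : 10 ^ 10 * G * S ≤ Y * S := by
      calc 10 ^ 10 * G * S = 10 ^ 8 * (m : ℝ) * (100 * lam) * ℓ := by rw [mul_assoc, hGS]; ring
        _ ≤ 10 ^ 8 * (m : ℝ) * A * B := by gcongr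
        _ ≤ Y * R := by rw [← hXR]; exact hYl
        _ ≤ Y * S := by gcongr
    exact le_of_mul_le_mul_right h1 hS0
  have hhi : (Y : ℝ) ≤ 1.05 * 10 ^ 10 * G := by
    have h1 : (X : ℝ) / R ≤ 1.03 * 10 ^ 10 * G := by
      rw [div_le_iff₀ hR0, hXR]
      calc 10 ^ 8 * (m : ℝ) * A * B ≤ 10 ^ 8 * m * (101 * lam) * (1.005 * ℓ) := by gcongr
        _ = 1.01505 * 10 ^ 10 * (G * S) := by rw [hGS]; ring
        _ = 10 ^ 10 * G * (1.01505 * S) := by ring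
        _ ≤ 10 ^ 10 * G * (1.03 * R) := by
          refine mul_le_mul_of_nonneg_left ?_ (by linarith)
          linarith
        _ = _ := by ring
    linarith
  have hu : (R * q ^ (R + 3) : ℕ) < 2 ^ (Nat.log 2 (R * q ^ (R + 3)) + 1) :=
    Nat.lt_pow_succ_log_self one_lt_two _
  have hu2 : ((Nat.log 2 (R * q ^ (R + 3)) + 1 : ℕ) : ℝ) ≤ G := by
    have h1 := Nat.log_le_logb_two (x := R * q ^ (R + 3)) (by positivity)
    rw [Nat.cast_mul, Nat.cast_pow, Real.logb_mul (by positivity) (by positivity),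
      Real.logb_pow] at h1
    have h2 : Real.logb 2 R ≤ R := by
      rw [Real.logb_le_iff_le_rpow one_lt_two hR0, Real.rpow_natCast]
      exact_mod_cast Nat.lt_two_pow_self.le
    have h3 : ((R + 3 : ℕ) : ℝ) * lam ≤ 4 * (S * lam) := by
      rw [← mul_assoc]
      refine mul_le_mul_of_nonneg_right ?_ (by linarith)
      push_cast
      linarith
    push_cast at h1 h3 ⊢
    linarith
  have hY20 : 20 * R ≤ Y := by
    have : 20 * (R : ℝ) ≤ Y := by linarith
    exact_mod_cast this
  refine ⟨by linarith, hlo, hhi, hY20, ?_, ?_, ?_, ?_, _, hu, hu2⟩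
  · exact Nat.le_two_pow_of_logb_le hN0 (by linarith)
  · exact Nat.le_two_pow_of_logb_le (by omega) (by linarith)
  · have h1 : m ≤ X := by
      rw [hX]
      have : 0 < A := hA ▸ Nat.succ_pos _
      have : 0 < B := hB ▸ Nat.succ_pos _
      calc m = 1 * m * 1 * 1 := by ring
        _ ≤ 10 ^ 8 * m * A * B := by gcongr <;> omega
    have h2 : X ≤ Y * R := by exact_mod_cast hYl
    have h3 : R ≤ Y := by omega
    have h4 : Y * Y ≤ 2 ^ Y := by
      have h5 : 4 ≤ Y := by
        have : (4 : ℝ) ≤ Y := by linarith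
        exact_mod_cast this
      exact Nat.mul_self_le_two_pow h5
    exact h1.trans (h2.trans ((Nat.mul_le_mul_left Y h3).trans h4))
  · have h1 : (Nat.log 2 (R * q ^ (R + 3)) + 1 : ℕ) ≤ Y := by
      have : ((Nat.log 2 (R * q ^ (R + 3)) + 1 : ℕ) : ℝ) ≤ Y := by linarith
      exact_mod_cast this
    exact (Nat.le_mul_of_pos_left _ hR0').trans
      (hu.le.trans (Nat.pow_le_pow_right two_pos h1))

/-! ### The reduction -/

theorem Fin.eq_mul_of_card_fiber {m b d : ℕ} (f : Fin m → Fin b)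
    (hd : ∀ y, Nat.card {e // f e = y} = d) : m = b * d := by
  have h := Finset.card_eq_sum_card_fiberwise (s := Finset.univ) (t := Finset.univ) (f := f)
    fun _ _ => Finset.mem_coe.2 (Finset.mem_univ _)
  have hd' : ∀ y, (Finset.univ.filter fun e => f e = y).card = d := by
    intro y
    rw [← hd y, Nat.card_eq_fintype_card, Fintype.card_subtype]
  simpa [hd'] using h

/-- The instances for which the parameters of the layout are polynomial in `2 ^ Y`. -/
structure AdmissibleInstance where
  (a b m q : ℕ)
  L : LabelCover (Fin a) (Fin b) (Fin m) (Fin q)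
  m_pos : 0 < m
  q_pos : 0 < q
  verts_le : a + b ≤ 2 ^ L.layout.Y
  q_le : q ≤ 2 ^ L.layout.Y
  m_le : m ≤ 2 ^ L.layout.Y
  qH_le : q ^ L.layout.H ≤ 2 ^ L.layout.Y

namespace AdmissibleInstance

theorem b_pos (I : AdmissibleInstance) : 0 < I.b :=
  (Nat.zero_le _).trans_lt (I.L.tgt ⟨0, I.m_pos⟩).2

/-- The context in which the machine starts. -/
def ctx : RAM.Ctx AdmissibleInstance where
  mem I := I.L.input
  size I := 2 ^ I.L.layout.Y
  two_le _ := Nat.le_self_pow (Nat.succ_ne_zero _) 2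
  width := 0
  holds _ _ := True
  congr _ _ _ _ h := h

theorem layout_ctx (I : AdmissibleInstance) : ctx.layout I = I.L.layout := by
  rw [RAM.Ctx.layout, LabelCover.layout]
  rfl

theorem good_ctx : ctx.Good where
  R_pos I := by
    rw [layout_ctx, LabelCover.layout_R]
    exact Nat.sqrt_pos.2 (Nat.add_pos_right _ I.b_pos)
  RB_pos I := by
    rw [layout_ctx, LabelCover.layout_RB]
    exact lt_min (Nat.sqrt_pos.2 (Nat.add_pos_right _ I.b_pos)) I.b_pos
  q_pos I := by
    rw [layout_ctx]
    exact I.q_pos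
  verts := RAM.Ctx.Poly.size.mono fun I => I.verts_le
  q := RAM.Ctx.Poly.size.mono fun I => by
    rw [layout_ctx]
    exact I.q_le
  m := RAM.Ctx.Poly.size.mono fun I => by
    rw [layout_ctx]
    exact I.m_le
  qH := RAM.Ctx.Poly.size.mono fun I => by
    rw [layout_ctx]
    exact I.qH_le
  pY := RAM.Ctx.Poly.size.mono fun I => by
    rw [layout_ctx]
    exact le_rfl
  src_le I e he := by
    rw [layout_ctx] at he ⊢
    exact (I.L.layout_src ⟨e, he⟩).trans_le ((I.L.src _).2.le.trans (Nat.le_add_right _ _))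
  tgt_le I e he := by
    rw [layout_ctx] at he ⊢
    exact (I.L.layout_tgt ⟨e, he⟩).trans_le ((I.L.tgt _).2.le.trans (Nat.le_add_left _ _))

/-- All admissible instances form one context, so a single program and a single exponent serve for
all of them. -/
theorem exists_program : ∃ (P : RAM.Program) (d : ℕ), ∀ (I : AdmissibleInstance) (ω : ℕ → Bool),
    ∃ t, RAM.Outputs P ω I.L.encode I.L.layout.table.encode t ∧ t ≤ (2 ^ I.L.layout.Y) ^ d := by
  obtain ⟨P, τ, ⟨d, hd⟩, hP⟩ := good_ctx.emits_table 0 le_rfl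
  refine ⟨P, d, fun I ω => ?_⟩
  obtain ⟨ρ, t, e, -, ht⟩ := hP I ω (RAM.initial I.L.encode) rfl trivial
  refine ⟨t, ⟨_, e, ?_⟩, ht.trans (hd I)⟩
  change (RAM.initial I.L.encode).out ++ (ctx.layout I).table.encode = _
  rw [layout_ctx]
  rfl

theorem numConcepts_le (I : AdmissibleInstance) :
    I.L.layout.numConcepts ≤ (2 ^ I.L.layout.Y) ^ 3 := by
  rw [Layout.numConcepts, pow_succ', pow_two]
  exact Nat.mul_le_mul_left _ (Nat.mul_le_mul_left _ I.qH_le)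

theorem numElems_le (I : AdmissibleInstance) :
    I.L.layout.numElems ≤ (2 ^ I.L.layout.Y) ^ 3 := by
  have hY : I.L.layout.Y ≤ 2 ^ I.L.layout.Y := Nat.lt_two_pow_self.le
  have h2 : 2 ≤ 2 ^ I.L.layout.Y := Nat.le_self_pow (Nat.succ_ne_zero _) 2
  calc I.L.layout.numElems ≤ 2 ^ I.L.layout.Y * 2 ^ I.L.layout.Y
        + 2 ^ I.L.layout.Y * 2 ^ I.L.layout.Y :=
      Nat.add_le_add (Nat.mul_le_mul_left _ hY) (Nat.mul_le_mul I.qH_le hY)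
    _ = 2 * (2 ^ I.L.layout.Y * 2 ^ I.L.layout.Y) := by ring
    _ ≤ 2 ^ I.L.layout.Y * (2 ^ I.L.layout.Y * 2 ^ I.L.layout.Y) := Nat.mul_le_mul_right _ h2
    _ = _ := by ring

end AdmissibleInstance

instance : MeasureTheory.IsProbabilityMeasure RAM.coinMeasure := by
  unfold RAM.coinMeasure
  infer_instance

theorem theorem4 :
    ∃ (P : RAM.Program) (c : ℝ), ∀ s : ℕ, ∃ n₀ : ℕ,
      ∀ (a b m q : ℕ) (L : LabelCover (Fin a) (Fin b) (Fin m) (Fin q)),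
        L.BiRegular → 0 < m → 2 ≤ q → q ≤ s → n₀ ≤ a + b →
        ∀ n r k T : ℝ,
          n = (a : ℝ) + (b : ℝ) →
          r = Real.sqrt n / Real.logb 2 n →
          k = 10 ^ 10 * (m : ℝ) * Real.logb 2 (q : ℝ) / r ^ 2 →
          T = (2 : ℝ) ^ (r * k) * (q : ℝ) ^ (c * ((m : ℝ) / r)) →
          ∃ D : (ℕ → Bool) → ConceptTable,
            (∀ ω, ∃ t : ℕ, RAM.Outputs P ω L.encode (D ω).encode t ∧ (t : ℝ) ≤ T) ∧
            (∀ ω, ((D ω).numConcepts : ℝ) ≤ T ∧ ((D ω).numElems : ℝ) ≤ T) ∧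
            (L.Satisfiable →
              ∀ ω, 2 * r * k ≤ (littlestoneDim (D ω).conceptClass : ℝ)) ∧
            (L.value ≤ 0.001 →
              ENNReal.ofReal (1 - 1 / n) ≤
                RAM.coinMeasure
                  {ω | (littlestoneDim (D ω).conceptClass : ℝ) ≤ (2 - 0.001) * r * k}) := by
  obtain ⟨P, d, hP⟩ := AdmissibleInstance.exists_program
  -- The exponent `d` bounds the time and `3` the size of the table, both as powers of `2 ^ Y`;
  -- `1.05 * 10 ^ 10` comes from `Y ≤ 1.05 * 10 ^ 10 * G`.
  refine ⟨P, 1.05 * 10 ^ 10 * (d + 3), fun s => ⟨2 ^ 200, ?_⟩⟩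
  intro a b m q L hL hm hq _ hn n r k T hn' hr hk hT
  obtain ⟨⟨dA, hdA⟩, dB, hdB⟩ := id hL
  have hmA := Fin.eq_mul_of_card_fiber L.src hdA
  have hmB := Fin.eq_mul_of_card_fiber L.tgt hdB
  -- As `m > 0`, both degrees are positive; so each side has at most `m` vertices, and `n ≤ 2 m`.
  have ha : a ≤ m := by
    rw [hmA]
    exact Nat.le_mul_of_pos_right _ (Nat.pos_of_mul_pos_left (hmA ▸ hm))
  have hb : b ≤ m := by
    rw [hmB]
    exact Nat.le_mul_of_pos_right _ (Nat.pos_of_mul_pos_left (hmB ▸ hm))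
  have hn0 : 0 < a + b := lt_of_lt_of_le (by positivity) hn
  have hnc : n = ((a + b : ℕ) : ℝ) := by
    rw [hn']
    push_cast
    rfl
  obtain ⟨G, hG⟩ : ∃ G, G = m * Real.logb 2 q * Real.logb 2 (a + b : ℕ) / √((a + b : ℕ) : ℝ) :=
    ⟨_, rfl⟩
  obtain ⟨hG1, hlo, hhi, hY20, hN, hqY, hmY, hH, u, hu, huG⟩ :=
    rounds_estimates hn (by omega) hq L.layout_R L.layout_Y hG
  let I : AdmissibleInstance := ⟨a, b, m, q, L, hm, by omega, hN, hqY, hmY, hH⟩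
  have hr0 : 0 < r := by
    rw [hr, hnc]
    refine div_pos (Real.sqrt_pos.2 (by exact_mod_cast hn0)) (Real.logb_pos one_lt_two ?_)
    have : 1 < a + b := lt_of_lt_of_le (by norm_num) hn
    exact_mod_cast this
  have hGr : m * Real.logb 2 q / r = G := by
    rw [hG, hr, hnc, div_div_eq_mul_div]
  have hrk : r * k = 10 ^ 10 * G := by
    rw [hk, ← hGr]
    field_simp
  have hq0 : (0 : ℝ) < q := by
    have : 0 < q := by omega
    exact_mod_cast this
  have hpow : ∀ e ≤ d + 3, (((2 ^ L.layout.Y) ^ e : ℕ) : ℝ) ≤ T := by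
    intro e he
    -- This is the identity `q ^ (m / r) = 2 ^ G`: the second factor of `T` alone dominates the
    -- required powers of `2 ^ Y`.
    have h1 : (q : ℝ) ^ (1.05 * 10 ^ 10 * ((d : ℝ) + 3) * ((m : ℝ) / r))
        = 2 ^ (1.05 * 10 ^ 10 * G * ((d : ℝ) + 3)) := by
      rw [← Real.rpow_logb two_pos (by norm_num) hq0, ← Real.rpow_mul zero_le_two, ← hGr]
      congr 1
      ring
    rw [hT, h1, ← pow_mul, Nat.cast_pow, Nat.cast_ofNat, ← Real.rpow_natCast,
      ← Real.rpow_add two_pos]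
    refine Real.rpow_le_rpow_of_exponent_le one_le_two ?_
    have he' : (e : ℝ) ≤ d + 3 := by exact_mod_cast he
    have h2 : ((L.layout.Y * e : ℕ) : ℝ) ≤ 1.05 * 10 ^ 10 * G * ((d : ℝ) + 3) := by
      rw [Nat.cast_mul]
      exact mul_le_mul hhi he' (Nat.cast_nonneg _) (by positivity)
    rw [hrk]
    linarith
  refine ⟨fun _ => L.layout.table, fun ω => ?_, fun _ => ⟨?_, ?_⟩, fun hsat _ => ?_, fun hval => ?_⟩
  · obtain ⟨t, ht, hle⟩ := hP I ω
    exact ⟨t, ht, (Nat.cast_le.2 hle).trans (hpow d (by omega))⟩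
  · exact (Nat.cast_le.2 I.numConcepts_le).trans (hpow 3 (by omega))
  · exact (Nat.cast_le.2 I.numElems_le).trans (hpow 3 (by omega))
  · have h : ((2 * L.layout.Y : ℕ) : ℝ) ≤ littlestoneDim L.layout.table.conceptClass :=
      Nat.cast_le.2 (hsat.le_littlestoneDim hn0 (by omega))
    rw [mul_assoc, hrk]
    push_cast at h
    linarith
  · have hR : 0 < L.layout.R := Nat.sqrt_pos.2 hn0
    have h := Layout.littlestoneDim_le hR hY20 hu
      fun s hs hsY σ => hL.exists_viol hm (by omega) hval hR (by omega) s hs hsY σ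
    -- Numerically, `u + 1.8 Y + 1 ≤ (1.89 * 10 ^ 10 + 2) * G`, below `1.999 * 10 ^ 10 * G`.
    have h1 : (littlestoneDim L.layout.table.conceptClass : ℝ) ≤ (2 - 0.001) * r * k := by
      have h2 : (5 * littlestoneDim L.layout.table.conceptClass : ℝ)
          ≤ 5 * u + 9 * L.layout.Y + 5 := by
        have : 5 * littlestoneDim L.layout.table.conceptClass
            ≤ 5 * u + 9 * L.layout.Y + 5 := by omega
        exact_mod_cast this
      rw [mul_assoc, hrk]
      linarith
    have h2 : {ω : ℕ → Bool | (littlestoneDim L.layout.table.conceptClass : ℝ)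
        ≤ (2 - 0.001) * r * k} = Set.univ := Set.eq_univ_of_forall fun _ => h1
    rw [h2, MeasureTheory.measure_univ]
    refine ENNReal.ofReal_le_one.2 (sub_le_self _ ?_)
    rw [hnc]
    positivity
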